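/- **Setting.** Consider a multistage stochastic program with $S$ scenarios $\xi^s=(\xi^s_1,\dots,\xi^s_{T-1})$, of probabilities $p_s>0$ with $\sum_s p_s=1$, and $T$ stages, with decisions $x^s=(x^s_1,\dots,x^s_T)\in\mathbb R^{n_1}\times\dots\times\mathbb R^{n_T}=\mathbb R^n$. Let $\mathcal B^s_t$ be the set of the scenarios $\sigma$ with $(\xi^\sigma_1,\dots,\xi^\sigma_{t-1})=(\xi^s_1,\dots,\xi^s_{t-1})$ and let $\mathcal W=\{x\in\mathbb R^{S\times n}: x^s_t=x^\sigma_t \text{ for all } t,\ s,\ \sigma\in\mathcal B^s_t\}$ be the non-anticipativity subspace. The problem is $$\min_{x\in\mathcal W}\ \sum_{s=1}^S p_s f^s(x^s).\qquad (1)$$ Assume that every $f^s:\mathbb R^n\to(-\infty,+\infty]$ is convex, proper and lower semicontinuous, that (1) has a solution, and that $\mathcal W$ meets the relative interior of the domain of the objective function. For $z\in\mathbb R^{S\times n}$ let $\Pi z\in\mathcal W$ be the bundle average, $(\Pi z)^s_t=\big(\sum_{\sigma\in\mathcal B^s_t}p_\sigma\big)^{-1}\sum_{\sigma\in\mathcal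 B^s_t}p_\sigma z^\sigma_t$. **Algorithm (Asynchronous Randomized Progressive Hedging).** Let $\mu>0$, let $q=(q_s)$ be a probability vector, $q_{\min}=\min_s q_s$, and $z^0=x^0\in\mathcal W$ deterministic. A master works with $M$ workers. Initially each worker $j$ holds some given scenario $s[j]$ (for instance $s[j]=j$), and $\bar x[j]=v[j]=x^{0,s[j]}$. At update $k=0,1,\dots$ some worker $i$ returns $y=\operatorname{argmin}_{u\in\mathbb R^n}\{f^{s[i]}(u)+\frac1{2\mu}\|u-v[i]\|^2\}$, and the master sets $$z^{k+1,s[i]}=z^{k,s[i]}+\frac{2\eta^k}{S\,q_{s[i]}}\,(y-\bar x[i]),\qquad z^{k+1,s}=z^{k,s}\ \ (s\ne s[i]).$$ It then draws a new scenario $s[i]$ for this worker, with probabilities $(q_s)$, and sets $\bar x[i]=(\Pi z^{k+1})^{s[i]}$ and $v[i]=2\bar x[i]-z^{k+1,s[i]}$. The output is $\tilde x^k=\Pi z^k$. The delay $d^k$ is defined by the fact that the result incorporated at update $k$ was computed from $z^{k-d^k}$. The order in which the workers return may be random. A drawn scenario is independent of the past at the time of its incorporation: if it is incorporated at update $k$,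 it has law $q$ conditionally on the workers that returned at updates $0,\dots,k$ and on the scenarios incorporated at updates $0,\dots,k-1$. (This holds in particular if the draws are i.i.d. with law $q$ and independent of the order in which the workers return.) **Theorem.** Suppose that, for a deterministic $\tau\in\mathbb N$, almost surely $d^k\le\tau$ for all $k$, and that the deterministic stepsizes satisfy, for some $\eta_{\min}$ and some $0<c<1$, $$0<\eta_{\min}\le\eta^k\le\frac{c\,S\,q_{\min}}{2\tau\sqrt{q_{\min}}+1}\qquad\text{for all }k.$$ Then almost surely $\tilde x^k\in\mathcal W$ for all $k$, and $(\tilde x^k)$ converges almost surely to a random variable that takes its values almost surely in the solution set of (1). -/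

import Mathlib

open MeasureTheory Filter Topology

namespace ProgHedging

noncomputable section

/-- The decision space of one scenario, `ℝ^{n_1} × ⋯ × ℝ^{n_T} = ℝ^n` with its Euclidean norm.
The coordinate `⟨t, i⟩` is the `i`-th coordinate of the decision at stage `t`. Stages are numbered
from `0`. -/
abbrev Row {T : ℕ} (n : Fin T → ℕ) : Type := EuclideanSpace ℝ (Σ t : Fin T, Fin (n t))

/-- The space `ℝ^{S × n}`: one decision row for each of the `S` scenarios. -/
abbrev Decision (S : ℕ) {T : ℕ} (n : Fin T → ℕ) : Type := Fin S → Row n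

/-- The data of a multistage stochastic program with `S` scenarios and `T` stages. Scenario `s` is
the realization `(ξ s 0, …, ξ s (T - 2))` of the uncertainty, it has probability `p s`, and its cost
function `f s` takes values in the extended reals (constraints are part of the cost). -/
structure Problem (S T : ℕ) (n : Fin T → ℕ) (Ξ : Fin (T - 1) → Type*) where
  /-- The scenarios. -/
  ξ : Fin S → (r : Fin (T - 1)) → Ξ r
  /-- The scenario probabilities. -/
  p : Fin S → ℝ
  /-- The scenario costs. -/
  f : Fin S → Row n → EReal

/-- Convexity of an extended-real-valued function: its epigraph is convex. -/
def ConvexFun {E : Type*} [AddCommGroup E] [Module ℝ E] (g : E → EReal) : Prop :=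
  Convex ℝ {a : E × ℝ | g a.1 ≤ (a.2 : EReal)}

/-- A proper function: it never takes the value `-∞` and is not identically `+∞`. -/
def ProperFun {E : Type*} (g : E → EReal) : Prop :=
  (∀ x, g x ≠ ⊥) ∧ ∃ x, g x ≠ ⊤

/-- `argmin_y { g y + ‖y - v‖² / (2 μ) }`. (For `g` convex, proper, lower semicontinuous and `μ > 0`
there is exactly one minimizer.) -/
def proxArgmin {E : Type*} [NormedAddCommGroup E] (g : E → EReal) (μ : ℝ) (v : E) : E :=
  Classical.epsilon fun y : E =>
    ∀ y' : E, g y + ((1 / (2 * μ) * ‖y - v‖ ^ 2 : ℝ) : EReal)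
      ≤ g y' + ((1 / (2 * μ) * ‖y' - v‖ ^ 2 : ℝ) : EReal)

namespace Problem

variable {S T : ℕ} {n : Fin T → ℕ} {Ξ : Fin (T - 1) → Type*} (D : Problem S T n Ξ)

/-- The scenarios `s` and `s'` are indistinguishable at stage `t`: the uncertainty revealed before
the decision of stage `t` is the same. (For the first stage, `t = 0`, this is always true.) -/
def Indist (t : Fin T) (s s' : Fin S) : Prop :=
  ∀ r : Fin (T - 1), (r : ℕ) < (t : ℕ) → D.ξ s r = D.ξ s' r

/-- The non-anticipativity subspace `𝒲` of `ℝ^{S × n}`. -/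
def nonant : Submodule ℝ (Decision S n) where
  carrier := {x | ∀ (s s' : Fin S) (t : Fin T), D.Indist t s s' →
    ∀ i : Fin (n t), x s ⟨t, i⟩ = x s' ⟨t, i⟩}
  add_mem' := by
    intro a b ha hb s s' t h i
    simp [ha s s' t h i, hb s s' t h i]
  zero_mem' := by
    intro s s' t _ i
    simp
  smul_mem' := by
    intro c a ha s s' t h i
    simp [ha s s' t h i]

/-- The objective function `∑ s, p_s f^s(x^s)`. -/
def objective (x : Decision S n) : EReal :=
  ∑ s, (D.p s : EReal) * D.f s (x s)

/-- The domain of the objective function. -/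
def dom : Set (Decision S n) := {x | D.objective x < ⊤}

/-- The set of solutions of `min_{x ∈ 𝒲} ∑ s, p_s f^s(x^s)`. -/
def solutions : Set (Decision S n) :=
  {x | x ∈ D.nonant ∧ ∀ y ∈ D.nonant, D.objective x ≤ D.objective y}

/-- The blanket assumptions: the scenario probabilities are positive (and sum to one); the costs are
convex, proper and lower semicontinuous; a solution exists; `𝒲` meets the relative interior of the
domain of the objective function. -/
structure Assumptions : Prop where
  p_pos : ∀ s, 0 < D.p s
  p_sum : ∑ s, D.p s = 1
  convex : ∀ s, ConvexFun (D.f s)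
  proper : ∀ s, ProperFun (D.f s)
  lsc : ∀ s, LowerSemicontinuous (D.f s)
  exists_solution : D.solutions.Nonempty
  qualification : ((D.nonant : Set (Decision S n)) ∩ intrinsicInterior ℝ D.dom).Nonempty

open Classical in
/-- The bundle of the scenarios that are indistinguishable from `s` at stage `t`. -/
def bundle (t : Fin T) (s : Fin S) : Finset (Fin S) :=
  Finset.univ.filter fun σ => D.Indist t s σ

/-- The average over bundles, weighted by the scenario probabilities:
`(proj z)_t^s = (∑_{σ ∈ B_t^s} p_σ)⁻¹ ∑_{σ ∈ B_t^s} p_σ z_t^σ`. -/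
def proj (z : Decision S n) : Decision S n := fun s =>
  WithLp.toLp 2 fun a : (Σ t : Fin T, Fin (n t)) =>
    (∑ σ ∈ D.bundle a.1 s, D.p σ)⁻¹ * ∑ σ ∈ D.bundle a.1 s, D.p σ * z σ a

end Problem

/-- The state of the asynchronous algorithm with `M` workers, just before an update of the master:
the master variable `z`, and for each worker `j` the scenario `scen j` it is treating, the point
`old j` that was averaged when `j` was last fed, the proximal centre `sent j` that was sent to `j`,
and the index `start j` of the master variable that was read when `j` was last fed. -/
structure State (S M : ℕ) {T : ℕ} (n : Fin T → ℕ) where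
  z : Decision S n
  scen : Fin M → Fin S
  old : Fin M → Row n
  sent : Fin M → Row n
  start : Fin M → ℕ

namespace Problem

variable {S T M : ℕ} {n : Fin T → ℕ} {Ξ : Fin (T - 1) → Type*} (D : Problem S T n Ξ)

/-- Initialization at `z⁰ = x⁰`: worker `j` is fed with the pair `(s₀ j, x⁰ (s₀ j))`. -/
def init (x₀ : Decision S n) (s₀ : Fin M → Fin S) : State S M n where
  z := x₀
  scen := s₀
  old := fun j => x₀ (s₀ j)
  sent := fun j => x₀ (s₀ j)
  start := fun _ => 0

/-- The update of the master variable `z` in update number `k`, when worker `i` returns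
`y = argmin { f^{s[i]}(y) + ‖y - sent[i]‖² / (2 μ) }`:
`z^{s[i]} ← z^{s[i]} + 2 η^k / (S q_{s[i]}) (y - old[i])`, the other rows being unchanged. -/
def updateZ (q : Fin S → ℝ) (μ : ℝ) (ηk : ℝ) (i : Fin M) (σ : State S M n) : Decision S n :=
  Function.update σ.z (σ.scen i)
    (σ.z (σ.scen i) + (2 * ηk / (S * q (σ.scen i))) •
      (proxArgmin (D.f (σ.scen i)) μ (σ.sent i) - σ.old i))

/-- Update number `k` of the master, with stepsize `ηk`: worker `i` returns its result, the master
variable becomes `z^{k+1}`, and worker `i` is fed anew with the scenario `s`, using `z^{k+1}`. -/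
def step (q : Fin S → ℝ) (μ : ℝ) (k : ℕ) (ηk : ℝ) (i : Fin M) (s : Fin S)
    (σ : State S M n) : State S M n :=
  let z' := D.updateZ q μ ηk i σ
  { z := z'
    scen := Function.update σ.scen i s
    old := Function.update σ.old i (D.proj z' s)
    sent := Function.update σ.sent i ((2 : ℝ) • D.proj z' s - z' s)
    start := Function.update σ.start i (k + 1) }

/-- The run of the algorithm: `w k` is the worker that returns at update `k`, and `draw k` is the
new scenario drawn for it. `D.run … k` is the state just before update `k`. -/
def run (x₀ : Decision S n) (s₀ : Fin M → Fin S) (q : Fin S → ℝ) (μ : ℝ) (η : ℕ → ℝ)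
    (w : ℕ → Fin M) (draw : ℕ → Fin S) : ℕ → State S M n
  | 0 => init x₀ s₀
  | k + 1 => D.step q μ k (η k) (w k) (draw k) (run x₀ s₀ q μ η w draw k)

/-- The output `x̃^k`: the average of `z^k` over all bundles. -/
def output (x₀ : Decision S n) (s₀ : Fin M → Fin S) (q : Fin S → ℝ) (μ : ℝ) (η : ℕ → ℝ)
    (w : ℕ → Fin M) (draw : ℕ → Fin S) (k : ℕ) : Decision S n :=
  D.proj (D.run x₀ s₀ q μ η w draw k).z

/-- The scenario incorporated by the master at update `k`, i.e. the one that the worker `w k`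
was treating. -/
def usedScen (x₀ : Decision S n) (s₀ : Fin M → Fin S) (q : Fin S → ℝ) (μ : ℝ) (η : ℕ → ℝ)
    (w : ℕ → Fin M) (draw : ℕ → Fin S) (k : ℕ) : Fin S :=
  (D.run x₀ s₀ q μ η w draw k).scen (w k)

/-- The delay `d^k`: the result incorporated at update `k` was computed from `z^{k - d^k}`.
(There is no truncation in the subtraction: the index read is at most `k`.) -/
def delay (x₀ : Decision S n) (s₀ : Fin M → Fin S) (q : Fin S → ℝ) (μ : ℝ) (η : ℕ → ℝ)
    (w : ℕ → Fin M) (draw : ℕ → Fin S) (k : ℕ) : ℕ :=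
  k - (D.run x₀ s₀ q μ η w draw k).start (w k)

end Problem

/-- The scenarios are sampled with probabilities `q`, independently of the past: `w k` is the worker
that returns at update `k` and `used k` the scenario it was treating. Unless this scenario is the
initial one of that worker (which is not drawn), it has the law `q` conditionally on the workers
`w 0, …, w k` that have returned so far and on the scenarios `used 0, …, used (k - 1)` incorporated
before. This is the case in particular if the draws are i.i.d. with law `q` and independent of the
order in which the workers return. -/
def SampledFrom {Ω : Type*} [MeasurableSpace Ω] (P : Measure Ω) {S M : ℕ} (q : Fin S → ℝ)
    (w : ℕ → Ω → Fin M) (used : ℕ → Ω → Fin S) : Prop :=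
  ∀ (k : ℕ) (s : Fin S) (a : ℕ → Fin M) (b : ℕ → Fin S), (∃ j < k, a j = a k) →
    P.real {ω | (∀ j ≤ k, w j ω = a j) ∧ (∀ j < k, used j ω = b j) ∧ used k ω = s}
      = q s * P.real {ω | (∀ j ≤ k, w j ω = a j) ∧ (∀ j < k, used j ω = b j)}

end

end ProgHedging

/-! Progressive hedging is Douglas–Rachford splitting for the weighted inner product `∑ s, p s * ⟪x
s, y s⟫`. Under it, the bundle average is the orthogonal projection on `𝒲`, and the proximal map of
the objective splits by scenario. The operator `G = I - R` (`drOp`), with `R` the composition of the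
two reflections, satisfies `‖Gx - Gy‖² ≤ 2⟪x - y, Gx - Gy⟫` (`cocoercive_drOp`). A zero `z` of `G`
projects to a solution (`proj_mem_solutions`), because `(Πz - z)/μ` is a subgradient orthogonal to
`𝒲`. A zero exists (`exists_drOp_eq_zero`), because the relative interior condition yields a
Lagrange multiplier.

Each update of the master is one coordinate step on `z` along `G`, evaluated at an outdated iterate,
with stepsize `η/S` divided by the probability of the coordinate (`run_z_succ`). This division makes
the step unbiased. The delay costs inner products of `G` with at most `τ` recent steps. Young's
inequality with parameter `β = √q_min` bounds them, and weighted squares of the last `τ` steps are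
added to `‖z - v‖²` to absorb them. For every zero `v`, the resulting Lyapunov function decreases in
conditional expectation by a multiple of `‖G‖²` at the point read (`expected_decrease`,
`setIntegral_atom_le`).

The Robbins–Siegmund argument then gives almost sure convergence of the Lyapunov function and `G →
0` along the points read. So the steps vanish, `G(z^k) → 0`, and the distances to the zeros in a
countable dense set converge. Opial's argument (`exists_tendsto_of_wInner_tendsto`) gives
convergence of `z^k` to a zero, and continuity of the projection finishes. -/

namespace ProgHedging

/-! ### Subgradients and proximal points -/

section Prox

open scoped RealInnerProductSpace

variable {E : Type*} [NormedAddCommGroup E] [InnerProductSpace ℝ E]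

/-- `u` is a subgradient of `g` at `x`, where `g` is finite. -/
def IsSubgrad (g : E → EReal) (x u : E) : Prop :=
  ∃ r : ℝ, g x = r ∧ ∀ y, ((r + ⟪u, y - x⟫ : ℝ) : EReal) ≤ g y

theorem IsSubgrad.monotone {g : E → EReal} {x y u v : E} (hu : IsSubgrad g x u)
    (hv : IsSubgrad g y v) : 0 ≤ ⟪u - v, x - y⟫ := by
  obtain ⟨r, hr, h1⟩ := hu
  obtain ⟨r', hr', h2⟩ := hv
  have a := h1 y
  have b := h2 x
  rw [hr'] at a
  rw [hr] at b
  have a' := EReal.coe_le_coe_iff.1 a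
  have b' := EReal.coe_le_coe_iff.1 b
  have e : ⟪u, y - x⟫ = -⟪u, x - y⟫ := by rw [← inner_neg_right, neg_sub]
  rw [inner_sub_left]
  linarith

/-- A lower semicontinuous function with an affine minorant has a proximal point. -/
theorem IsSubgrad.exists_prox [FiniteDimensional ℝ E] {g : E → EReal} {x u : E}
    (hu : IsSubgrad g x u) (hbot : ∀ y, g y ≠ ⊥) (hg : LowerSemicontinuous g) {μ : ℝ}
    (hμ : 0 < μ) (v : E) :
    ∃ y, ∀ y', g y + ((1 / (2 * μ) * ‖y - v‖ ^ 2 : ℝ) : EReal)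
      ≤ g y' + ((1 / (2 * μ) * ‖y' - v‖ ^ 2 : ℝ) : EReal) := by
  obtain ⟨r, hr, h1⟩ := hu
  have hlsc : LowerSemicontinuous
      fun y => g y + ((1 / (2 * μ) * ‖y - v‖ ^ 2 : ℝ) : EReal) := by
    refine LowerSemicontinuous.add' hg ?_ fun y => ?_
    · exact (continuous_coe_real_ereal.comp (by fun_prop)).lowerSemicontinuous
    · exact EReal.continuousAt_add (Or.inr (EReal.coe_ne_bot _)) (Or.inl (hbot y))
  set K : ℝ := ‖u‖ * ‖v - x‖ + 1 / (2 * μ) * ‖x - v‖ ^ 2 with hK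
  have hK0 : 0 ≤ K := by positivity
  -- Beyond this radius `ρ ≥ 1` and `ρ²/(2μ) ≥ (‖u‖ + K)ρ ≥ ‖u‖ρ + K`, so the affine minorant plus
  -- the quadratic term exceeds the value at `x`. The second argument of the maximum keeps `x` in
  -- the ball.
  set R : ℝ := max (2 * μ * (‖u‖ + K) + 1) ‖x - v‖ with hR
  have hx : x ∈ Metric.closedBall v R := by
    rw [Metric.mem_closedBall, dist_eq_norm]; exact le_max_right _ _
  obtain ⟨y, hy, hmin⟩ := LowerSemicontinuousOn.exists_isMinOn ⟨x, hx⟩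
    (isCompact_closedBall v R) (hlsc.lowerSemicontinuousOn _)
  refine ⟨y, fun y' => ?_⟩
  by_cases hy' : y' ∈ Metric.closedBall v R
  · exact hmin hy'
  · refine (hmin hx).trans ?_
    simp only [hr]
    have hρ : R < ‖y' - v‖ := by
      rwa [Metric.mem_closedBall, dist_eq_norm, not_le] at hy'
    have hρ1 : 2 * μ * (‖u‖ + K) + 1 ≤ ‖y' - v‖ := (le_max_left _ _).trans hρ.le
    set ρ := ‖y' - v‖
    have hi : -(‖u‖ * (ρ + ‖v - x‖)) ≤ ⟪u, y' - x⟫ := by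
      have h2 : ‖y' - x‖ ≤ ρ + ‖v - x‖ := by
        have : y' - x = (y' - v) + (v - x) := by abel
        rw [this]; exact norm_add_le _ _
      have h3 := abs_real_inner_le_norm u (y' - x)
      have h4 := neg_abs_le ⟪u, y' - x⟫
      have h5 := mul_le_mul_of_nonneg_left h2 (norm_nonneg u)
      linarith
    have h6 : ‖u‖ + K ≤ 1 / (2 * μ) * ρ := by
      rw [one_div, inv_mul_eq_div, le_div_iff₀ (by positivity)]
      linarith
    have h7 : 1 ≤ ρ := by
      have : 0 ≤ 2 * μ * (‖u‖ + K) := by positivity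
      linarith
    have h8 : (‖u‖ + K) * ρ ≤ 1 / (2 * μ) * ρ * ρ :=
      mul_le_mul_of_nonneg_right h6 (by linarith)
    have h9 : K ≤ K * ρ := le_mul_of_one_le_right hK0 h7
    calc (r : EReal) + ((1 / (2 * μ) * ‖x - v‖ ^ 2 : ℝ) : EReal)
        ≤ ((r + ⟪u, y' - x⟫ : ℝ) : EReal) + ((1 / (2 * μ) * ρ ^ 2 : ℝ) : EReal) := by
          rw [← EReal.coe_add, ← EReal.coe_add, EReal.coe_le_coe_iff]
          have : 1 / (2 * μ) * ρ ^ 2 = 1 / (2 * μ) * ρ * ρ := by ring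
          nlinarith
      _ ≤ _ := by gcongr; exact h1 y'

/-- Optimality condition for a proximal point of a convex function. -/
theorem isSubgrad_of_prox {g : E → EReal} (hc : ConvexFun g) (hp : ProperFun g) {μ : ℝ}
    (hμ : 0 < μ) {v y : E}
    (hy : ∀ y', g y + ((1 / (2 * μ) * ‖y - v‖ ^ 2 : ℝ) : EReal)
      ≤ g y' + ((1 / (2 * μ) * ‖y' - v‖ ^ 2 : ℝ) : EReal)) :
    IsSubgrad g y ((1 / μ) • (v - y)) := by
  obtain ⟨hbot, x, hx⟩ := hp
  have hytop : g y ≠ ⊤ := by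
    intro h
    have h1 := hy x
    rw [h, EReal.top_add_coe, top_le_iff, ← EReal.coe_toReal hx (hbot x), ← EReal.coe_add] at h1
    exact EReal.coe_ne_top _ h1
  have hr : g y = ((g y).toReal : EReal) := (EReal.coe_toReal hytop (hbot y)).symm
  refine ⟨(g y).toReal, hr, fun y' => ?_⟩
  by_cases htop : g y' = ⊤
  · rw [htop]; exact le_top
  have hr' : g y' = ((g y').toReal : EReal) := (EReal.coe_toReal htop (hbot y')).symm
  set r := (g y).toReal
  set r' := (g y').toReal
  rw [hr', EReal.coe_le_coe_iff]
  -- Comparison of `y` with `y + t (y' - y)`, using convexity and division by `t`; the limit `t →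
  -- 0⁺` removes the quadratic term.
  have key : ∀ t : ℝ, 0 < t → t ≤ 1 →
      0 ≤ (r' - r + 1 / μ * ⟪y - v, y' - y⟫) + t * (1 / (2 * μ) * ‖y' - y‖ ^ 2) := by
    intro t ht ht1
    have hcv := hc (x := (y, r)) (by simp [hr]) (y := (y', r')) (by simp [hr'])
      (sub_nonneg.2 ht1) ht.le (by ring)
    simp only [Set.mem_ofPred_eq, Prod.smul_mk, Prod.mk_add_mk, smul_eq_mul] at hcv
    have h1 := (hy ((1 - t) • y + t • y')).trans (add_le_add_left hcv _)
    rw [hr, ← EReal.coe_add, ← EReal.coe_add, EReal.coe_le_coe_iff] at h1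
    have e : (1 - t) • y + t • y' - v = (y - v) + t • (y' - y) := by
      simp only [sub_smul, smul_sub, one_smul]; abel
    rw [e, norm_add_sq_real, inner_smul_right, norm_smul, Real.norm_eq_abs, abs_of_pos ht] at h1
    have h2 : 0 ≤ t * ((r' - r + 1 / μ * ⟪y - v, y' - y⟫)
        + t * (1 / (2 * μ) * ‖y' - y‖ ^ 2)) := by
      have : (1 : ℝ) / μ = 2 * (1 / (2 * μ)) := by field_simp
      rw [this]
      nlinarith
    exact nonneg_of_mul_nonneg_right h2 ht
  have lim : 0 ≤ r' - r + 1 / μ * ⟪y - v, y' - y⟫ := by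
    have ht : Tendsto (fun t : ℝ => (r' - r + 1 / μ * ⟪y - v, y' - y⟫)
        + t * (1 / (2 * μ) * ‖y' - y‖ ^ 2)) (𝓝[>] 0)
        (𝓝 ((r' - r + 1 / μ * ⟪y - v, y' - y⟫) + 0 * (1 / (2 * μ) * ‖y' - y‖ ^ 2))) :=
      (Continuous.tendsto (by fun_prop) 0).mono_left nhdsWithin_le_nhds
    rw [zero_mul, add_zero] at ht
    refine ge_of_tendsto ht ?_
    filter_upwards [Ioc_mem_nhdsGT (zero_lt_one (α := ℝ))] with t ht
    exact key t ht.1 ht.2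
  have e2 : ⟪(1 / μ) • (v - y), y' - y⟫ = -(1 / μ * ⟪y - v, y' - y⟫) := by
    rw [real_inner_smul_left, ← neg_sub y v, inner_neg_left]; ring
  rw [e2]
  linarith

theorem IsSubgrad.isSubgrad_proxArgmin [FiniteDimensional ℝ E] {g : E → EReal} {x u : E}
    (hu : IsSubgrad g x u) (hc : ConvexFun g) (hp : ProperFun g) (hg : LowerSemicontinuous g)
    {μ : ℝ} (hμ : 0 < μ) (v : E) :
    IsSubgrad g (proxArgmin g μ v) ((1 / μ) • (v - proxArgmin g μ v)) :=
  isSubgrad_of_prox hc hp hμ (Classical.epsilon_spec (hu.exists_prox hp.1 hg hμ v))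

/-- The proximal point of `x + μ u` is `x` when `u` is a subgradient at `x`. -/
theorem IsSubgrad.proxArgmin_eq [FiniteDimensional ℝ E] {g : E → EReal} {x u : E}
    (hu : IsSubgrad g x u) (hc : ConvexFun g) (hp : ProperFun g) (hg : LowerSemicontinuous g)
    {μ : ℝ} (hμ : 0 < μ) : proxArgmin g μ (x + μ • u) = x := by
  have h := (hu.isSubgrad_proxArgmin hc hp hg hμ (x + μ • u)).monotone hu
  set y := proxArgmin g μ (x + μ • u)
  have e : (1 / μ) • (x + μ • u - y) - u = -((1 / μ) • (y - x)) := by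
    simp only [smul_sub, smul_add, smul_smul]
    rw [one_div_mul_cancel hμ.ne', one_smul]; abel
  rw [e, inner_neg_left, real_inner_smul_left, real_inner_self_eq_norm_sq] at h
  have h1 : 0 ≤ 1 / μ * ‖y - x‖ ^ 2 := by positivity
  have h2 : 1 / μ * ‖y - x‖ ^ 2 = 0 := by linarith
  have h3 : ‖y - x‖ = 0 := by
    rcases mul_eq_zero.1 h2 with h | h
    · exact absurd h (by positivity)
    · exact pow_eq_zero_iff (two_ne_zero) |>.1 h
  exact sub_eq_zero.1 (norm_eq_zero.1 h3)

/-- The proximal operator is firmly nonexpansive. -/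
theorem IsSubgrad.proxArgmin_firm [FiniteDimensional ℝ E] {g : E → EReal} {x u : E}
    (hu : IsSubgrad g x u) (hc : ConvexFun g) (hp : ProperFun g) (hg : LowerSemicontinuous g)
    {μ : ℝ} (hμ : 0 < μ) (v w : E) :
    0 ≤ ⟪proxArgmin g μ v - proxArgmin g μ w,
      (v - w) - (proxArgmin g μ v - proxArgmin g μ w)⟫ := by
  have h := (hu.isSubgrad_proxArgmin hc hp hg hμ v).monotone
    (hu.isSubgrad_proxArgmin hc hp hg hμ w)
  rw [← smul_sub, real_inner_smul_left] at h
  have h1 := nonneg_of_mul_nonneg_right h (by positivity)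
  rwa [real_inner_comm, sub_sub_sub_comm]

end Prox

/-! ### Lagrange multipliers by extension of positive functionals -/

section Multiplier

/-- A Lagrange multiplier for the minimization of a convex function `φ` with domain `C` over a
subspace `W` that meets the relative interior of `C`. -/
theorem exists_multiplier {E : Type*} [AddCommGroup E] [Module ℝ E] [TopologicalSpace E]
    [IsTopologicalAddGroup E] [ContinuousSMul ℝ E] {C : Set E} {φ : E → ℝ}
    (hφ : ConvexOn ℝ C φ) {W : Submodule ℝ E} {x₁ : E} (hxC : x₁ ∈ C) (hxW : x₁ ∈ W)
    (hmin : ∀ y ∈ C, y ∈ W → φ x₁ ≤ φ y) {x₀ : E} (hx₀W : x₀ ∈ W)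
    (hx₀ : x₀ ∈ intrinsicInterior ℝ C) :
    ∃ ℓ : E →ₗ[ℝ] ℝ, (∀ w ∈ W, ℓ w = 0) ∧ ∀ y ∈ C, φ x₁ + ℓ (y - x₁) ≤ φ y := by
  set V : Submodule ℝ E := W ⊔ vectorSpan ℝ C with hV
  -- The complement `V'` takes care of the directions that neither `W` nor the span of `C` reaches:
  -- it is put in the domain of the functional, where it cannot interact with the cone.
  obtain ⟨V', hV'⟩ := Submodule.exists_isCompl V
  -- Cone generated by the epigraph of `φ` translated by `(x₁, φ x₁)`. A functional nonnegative on
  -- it that extends the second coordinate is a nonvertical supporting hyperplane.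
  let K₀ : ConvexCone ℝ (E × ℝ) :=
    { carrier := {a | ∃ l : ℝ, 0 < l ∧ ∃ x ∈ C, l • (x - x₁) = a.1 ∧ l * (φ x - φ x₁) ≤ a.2}
      smul_mem' := by
        rintro c hc ⟨a, r⟩ ⟨l, hl, x, hx, h1, h2⟩
        refine ⟨c * l, mul_pos hc hl, x, hx, ?_, ?_⟩
        · rw [Prod.smul_mk, mul_smul]; exact congrArg (c • ·) h1
        · simp only [Prod.smul_mk, smul_eq_mul, mul_assoc]
          exact mul_le_mul_of_nonneg_left h2 hc.le
      add_mem' := by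
        rintro ⟨a, r⟩ ⟨l, hl, x, hx, h1, h2⟩ ⟨a', r'⟩ ⟨l', hl', x', hx', h1', h2'⟩
        have hs : 0 < l + l' := add_pos hl hl'
        have hcv := hφ.2 hx hx' (div_nonneg hl.le hs.le) (div_nonneg hl'.le hs.le)
          (by field_simp)
        refine ⟨l + l', hs, (l / (l + l')) • x + (l' / (l + l')) • x',
          hφ.1 hx hx' (div_nonneg hl.le hs.le) (div_nonneg hl'.le hs.le) (by field_simp),
          ?_, ?_⟩
        · dsimp only at h1 h1'
          simp only [Prod.mk_add_mk, ← h1, ← h1', smul_sub, smul_add, smul_smul, add_smul,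
            mul_div_cancel₀ _ hs.ne']
          abel
        · simp only [Prod.mk_add_mk]
          simp only [smul_eq_mul] at hcv
          have := mul_le_mul_of_nonneg_left hcv hs.le
          have e : (l + l') * (l / (l + l') * φ x + l' / (l + l') * φ x') = l * φ x + l' * φ x' := by
            field_simp
          rw [e] at this
          simp only at h2 h2'
          linarith }
  have hK₀ : K₀.Pointed := ⟨1, one_pos, x₁, hxC, by simp, by simp⟩
  let p : (E × ℝ) →ₗ.[ℝ] ℝ :=
    { domain := Submodule.prod (W ⊔ V') ⊤
      toFun := (LinearMap.snd ℝ E ℝ).comp (Submodule.subtype _) }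
  have hnn : ∀ x : p.domain, (x : E × ℝ) ∈ K₀.toPointedCone hK₀ → 0 ≤ p x := by
    rintro ⟨⟨a, r⟩, ha⟩ ⟨l, hl, x, hx, h1, h2⟩
    change 0 ≤ r
    simp only at h1 h2
    have haW : a ∈ W := by
      obtain ⟨w, hw, v', hv', e⟩ := Submodule.mem_sup.1 ha.1
      simp only at e
      have h3 : v' ∈ V := by
        have : v' = a - w := by rw [← e]; abel
        rw [this, ← h1]
        refine sub_mem (Submodule.smul_mem _ _ ?_) (Submodule.mem_sup_left hw)
        exact Submodule.mem_sup_right (vsub_mem_vectorSpan ℝ hx hxC)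
      have h4 : v' = 0 := Submodule.disjoint_def.1 hV'.disjoint _ h3 hv'
      rw [← e, h4, add_zero]; exact hw
    have hxW' : x ∈ W := by
      have : x = l⁻¹ • a + x₁ := by
        rw [← h1, smul_smul, inv_mul_cancel₀ hl.ne', one_smul]; abel
      rw [this]
      exact add_mem (Submodule.smul_mem _ _ haW) hxW
    have := mul_nonneg hl.le (sub_nonneg.2 (hmin x hx hxW'))
    linarith
  have hdense : ∀ y, ∃ x : p.domain, (x : E × ℝ) + y ∈ K₀.toPointedCone hK₀ := by
    rintro ⟨y, ρ⟩
    have hy : y ∈ V ⊔ V' := by rw [hV'.sup_eq_top]; trivial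
    obtain ⟨v, hv, v', hv', rfl⟩ := Submodule.mem_sup.1 hy
    obtain ⟨w, hw, d, hd, rfl⟩ := Submodule.mem_sup.1 hv
    -- The only use of the relative interior: `x₀` can be moved slightly inside `C` in any direction
    -- of its span.
    obtain ⟨ε, hε, hεC⟩ : ∃ ε : ℝ, 0 < ε ∧ x₀ + ε • d ∈ C := by
      obtain ⟨y₀, hy₀, rfl⟩ := mem_intrinsicInterior.1 hx₀
      have hmem : ∀ t : ℝ, (y₀ : E) + t • d ∈ affineSpan ℝ C := fun t => by
        rw [add_comm]
        refine AffineSubspace.vadd_mem_of_mem_direction ?_ y₀.2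
        rw [direction_affineSpan]
        exact Submodule.smul_mem _ _ hd
      have hcont : Continuous fun t : ℝ => (⟨(y₀ : E) + t • d, hmem t⟩ : affineSpan ℝ C) :=
        Continuous.subtype_mk (by fun_prop) _
      have h0 : (⟨(y₀ : E) + (0 : ℝ) • d, hmem 0⟩ : affineSpan ℝ C) = y₀ := by
        ext; simp
      have hev : ∀ᶠ t : ℝ in 𝓝 0, (y₀ : E) + t • d ∈ C := by
        have := hcont.continuousAt (x := 0)
        have hn : (↑) ⁻¹' C ∈ 𝓝 (⟨(y₀ : E) + (0 : ℝ) • d, hmem 0⟩ : affineSpan ℝ C) := by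
          rw [h0]; exact mem_interior_iff_mem_nhds.1 hy₀
        exact this hn
      have hev' : ∀ᶠ t : ℝ in 𝓝[>] 0, (y₀ : E) + t • d ∈ C := hev.filter_mono nhdsWithin_le_nhds
      obtain ⟨t, ht, ht'⟩ := (hev'.and self_mem_nhdsWithin).exists
      exact ⟨t, ht', ht⟩
    have hmem : (ε⁻¹ • (x₀ - x₁) - w) + -v' ∈ W ⊔ V' :=
      Submodule.add_mem_sup (sub_mem (Submodule.smul_mem _ _ (sub_mem hx₀W hxW)) hw)
        (neg_mem hv')
    -- Chosen so that adding `(w + d + v', ρ)` gives exactly the generator of the cone at `x₀ + ε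
    -- d`, scaled by `ε⁻¹`.
    refine ⟨⟨((ε⁻¹ • (x₀ - x₁) - w) + -v', ε⁻¹ * (φ (x₀ + ε • d) - φ x₁) - ρ), hmem, trivial⟩,
      ε⁻¹, inv_pos.2 hε, x₀ + ε • d, hεC, ?_, ?_⟩
    · simp only [Prod.mk_add_mk]
      have : x₀ + ε • d - x₁ = (x₀ - x₁) + ε • d := by abel
      rw [this, smul_add, smul_smul, inv_mul_cancel₀ hε.ne', one_smul]
      abel
    · simp
  obtain ⟨g, hg1, hg2⟩ := riesz_extension _ p hnn hdense
  refine ⟨-(g.comp (LinearMap.inl ℝ E ℝ)), fun w hw => ?_, fun y hy => ?_⟩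
  · have := hg1 ⟨(w, 0), Submodule.mem_sup_left hw, trivial⟩
    have e : p ⟨(w, 0), Submodule.mem_sup_left hw, trivial⟩ = 0 := rfl
    rw [e] at this
    simpa using this
  · have h1 : g (0, φ y - φ x₁) = φ y - φ x₁ :=
      hg1 ⟨(0, φ y - φ x₁), zero_mem _, trivial⟩
    have h2 : 0 ≤ g (y - x₁, φ y - φ x₁) :=
      hg2 _ ⟨1, one_pos, y, hy, one_smul _ _, by simp⟩
    have h3 : g (y - x₁, φ y - φ x₁) = g (y - x₁, 0) + g (0, φ y - φ x₁) := by
      rw [← map_add]; simp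
    rw [h3, h1] at h2
    simp only [LinearMap.neg_apply, LinearMap.comp_apply, LinearMap.inl_apply]
    linarith

end Multiplier

/-! ### The objective and its multipliers by scenario -/

namespace Problem

open scoped RealInnerProductSpace

variable {S T : ℕ} {n : Fin T → ℕ} {Ξ : Fin (T - 1) → Type*} {D : Problem S T n Ξ}

theorem objective_eq_coe {x : Decision S n} {r : Fin S → ℝ} (h : ∀ s, D.f s (x s) = r s) :
    D.objective x = ((∑ s, D.p s * r s : ℝ) : EReal) := by
  have hsum : ∀ a : Fin S → ℝ, ((∑ s, a s : ℝ) : EReal) = ∑ s, (a s : EReal) := fun a =>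
    map_sum (⟨⟨fun r : ℝ => (r : EReal), EReal.coe_zero⟩, EReal.coe_add⟩ : ℝ →+ EReal) a Finset.univ
  rw [objective, hsum]
  exact Finset.sum_congr rfl fun s _ => by rw [h, EReal.coe_mul]

/-- No term of the sum is `⊥`, so one infinite cost makes the whole sum `⊤`; in `EReal` a `⊥` term
would have absorbed it. -/
theorem Assumptions.mem_dom_iff (hD : D.Assumptions) {x : Decision S n} :
    x ∈ D.dom ↔ ∀ s, D.f s (x s) ≠ ⊤ := by
  constructor
  · intro hx s hs
    have hne : ∀ t : Finset (Fin S), ∑ s ∈ t, (D.p s : EReal) * D.f s (x s) ≠ ⊥ := by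
      intro t
      refine Finset.sum_induction _ (· ≠ ⊥) (fun a b ha hb => by simp [EReal.add_eq_bot_iff, ha, hb])
        EReal.zero_ne_bot fun s _ => ?_
      by_cases h : D.f s (x s) = ⊤
      · rw [h, EReal.coe_mul_top_of_pos (hD.p_pos s)]; exact top_ne_bot
      · rw [← EReal.coe_toReal h ((hD.proper s).1 _), ← EReal.coe_mul]
        exact EReal.coe_ne_bot _
    have h1 : D.objective x = ⊤ := by
      rw [objective, ← Finset.add_sum_erase _ _ (Finset.mem_univ s), hs,
        EReal.coe_mul_top_of_pos (hD.p_pos s), EReal.top_add_of_ne_bot (hne _)]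
    exact (ne_of_lt hx) h1
  · intro h
    change D.objective x < ⊤
    rw [objective_eq_coe fun s => (EReal.coe_toReal (h s) ((hD.proper s).1 _)).symm]
    exact EReal.coe_lt_top _

theorem Assumptions.objective_eq (hD : D.Assumptions) {x : Decision S n} (hx : x ∈ D.dom) :
    D.objective x = ((∑ s, D.p s * (D.f s (x s)).toReal : ℝ) : EReal) :=
  objective_eq_coe fun s => (EReal.coe_toReal (hD.mem_dom_iff.1 hx s) ((hD.proper s).1 _)).symm

theorem Assumptions.convexOn_dom (hD : D.Assumptions) :
    ConvexOn ℝ D.dom fun x => ∑ s, D.p s * (D.f s (x s)).toReal := by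
  have key : ∀ x ∈ D.dom, ∀ y ∈ D.dom, ∀ a b : ℝ, 0 ≤ a → 0 ≤ b → a + b = 1 → ∀ s,
      D.f s ((a • x + b • y) s)
        ≤ ((a * (D.f s (x s)).toReal + b * (D.f s (y s)).toReal : ℝ) : EReal) := by
    intro x hx y hy a b ha hb hab s
    have hx' := EReal.coe_toReal (hD.mem_dom_iff.1 hx s) ((hD.proper s).1 _)
    have hy' := EReal.coe_toReal (hD.mem_dom_iff.1 hy s) ((hD.proper s).1 _)
    exact hD.convex s (x := (x s, (D.f s (x s)).toReal)) hx'.symm.le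
      (y := (y s, (D.f s (y s)).toReal)) hy'.symm.le ha hb hab
  have hconv : Convex ℝ D.dom := by
    intro x hx y hy a b ha hb hab
    rw [hD.mem_dom_iff]
    intro s h
    have := key x hx y hy a b ha hb hab s
    rw [h, top_le_iff] at this
    exact EReal.coe_ne_top _ this
  refine ⟨hconv, fun x hx y hy a b ha hb hab => ?_⟩
  simp only [smul_eq_mul, Finset.mul_sum, ← Finset.sum_add_distrib]
  refine Finset.sum_le_sum fun s _ => ?_
  have h1 := EReal.toReal_le_toReal (key x hx y hy a b ha hb hab s) ((hD.proper s).1 _)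
    (EReal.coe_ne_top _)
  rw [EReal.toReal_coe] at h1
  have := mul_le_mul_of_nonneg_left h1 (hD.p_pos s).le
  linarith

/-- A solution of the problem, with subgradients that are orthogonal to the non-anticipativity
subspace. -/
theorem Assumptions.exists_multiplier (hD : D.Assumptions) :
    ∃ x u : Decision S n, x ∈ D.nonant ∧ (∀ s, IsSubgrad (D.f s) (x s) (u s)) ∧
      ∀ w ∈ D.nonant, ∑ s, D.p s * ⟪u s, w s⟫ = 0 := by
  obtain ⟨x, hxW, hmin⟩ := hD.exists_solution
  obtain ⟨x₀, hx₀W, hx₀⟩ := hD.qualification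
  have hx : x ∈ D.dom := by
    have h : x₀ ∈ D.dom := intrinsicInterior_subset hx₀
    exact lt_of_le_of_lt (hmin x₀ hx₀W) h
  have hmin' : ∀ y ∈ D.dom, y ∈ D.nonant → ∑ s, D.p s * (D.f s (x s)).toReal
      ≤ ∑ s, D.p s * (D.f s (y s)).toReal := by
    intro y hy hyW
    have := hmin y hyW
    rwa [hD.objective_eq hx, hD.objective_eq hy, EReal.coe_le_coe_iff] at this
  obtain ⟨ℓ, hℓW, hℓ⟩ := ProgHedging.exists_multiplier hD.convexOn_dom hx hxW hmin' hx₀W hx₀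
  -- Riesz representative of `ℓ` on row `s`, divided by `p s` because orthogonality is meant for the
  -- weighted inner product.
  let u : Decision S n := fun s => (D.p s)⁻¹ • (InnerProductSpace.toDual ℝ (Row n)).symm
    (LinearMap.toContinuousLinearMap (ℓ.comp (LinearMap.single ℝ (fun _ : Fin S => Row n) s)))
  have hu : ∀ s v, D.p s * ⟪u s, v⟫ = ℓ (Pi.single s v) := by
    intro s v
    simp only [u, real_inner_smul_left, InnerProductSpace.toDual_symm_apply]
    rw [mul_inv_cancel_left₀ (hD.p_pos s).ne']
    rfl
  refine ⟨x, u, hxW, fun s => ?_, fun w hw => ?_⟩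
  · refine ⟨(D.f s (x s)).toReal,
      (EReal.coe_toReal (hD.mem_dom_iff.1 hx s) ((hD.proper s).1 _)).symm, fun y => ?_⟩
    by_cases hy : D.f s y = ⊤
    · rw [hy]; exact le_top
    rw [← EReal.coe_toReal hy ((hD.proper s).1 _), EReal.coe_le_coe_iff]
    -- Perturbing the solution in row `s` alone cancels the other costs and leaves the subgradient
    -- inequality of `f s`.
    have hx' : Function.update x s y ∈ D.dom := by
      rw [hD.mem_dom_iff]
      intro s'
      by_cases h : s' = s
      · subst h; rwa [Function.update_self]
      · rw [Function.update_of_ne h]; exact hD.mem_dom_iff.1 hx s'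
    have h1 := hℓ _ hx'
    have h2 : Function.update x s y - x = Pi.single s (y - x s) := by
      ext1 s'
      by_cases h : s' = s
      · subst h; simp
      · simp [h]
    rw [h2, ← hu, ← Finset.add_sum_erase _ _ (Finset.mem_univ s),
      ← Finset.add_sum_erase Finset.univ
        (fun s' => D.p s' * (D.f s' (Function.update x s y s')).toReal) (Finset.mem_univ s),
      Function.update_self] at h1
    have h3 : ∑ s' ∈ Finset.univ.erase s, D.p s' * (D.f s' (Function.update x s y s')).toReal
        = ∑ s' ∈ Finset.univ.erase s, D.p s' * (D.f s' (x s')).toReal :=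
      Finset.sum_congr rfl fun s' hs' => by rw [Function.update_of_ne (Finset.ne_of_mem_erase hs')]
    rw [h3] at h1
    refine le_of_mul_le_mul_left ?_ (hD.p_pos s)
    linarith
  · simp only [hu]
    rw [← map_sum, Finset.univ_sum_single]
    exact hℓW w hw

end Problem

/-! ### Weighted inner product and cocoercive operators -/

section WeightedInner

open scoped RealInnerProductSpace

variable {ι E : Type*} [Fintype ι] [NormedAddCommGroup E] [InnerProductSpace ℝ E]

/-- The weighted inner product `∑ s, p_s ⟪x_s, y_s⟫`. -/
noncomputable def wInner (p : ι → ℝ) (x y : ι → E) : ℝ := ∑ s, p s * ⟪x s, y s⟫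

variable {p : ι → ℝ}

theorem wInner_comm (x y : ι → E) : wInner p x y = wInner p y x := by
  simp only [wInner, real_inner_comm]

theorem wInner_add_left (x y z : ι → E) : wInner p (x + y) z = wInner p x z + wInner p y z := by
  simp only [wInner, Pi.add_apply, inner_add_left, mul_add, Finset.sum_add_distrib]

theorem wInner_smul_left (c : ℝ) (x z : ι → E) : wInner p (c • x) z = c * wInner p x z := by
  simp only [wInner, Pi.smul_apply, real_inner_smul_left, Finset.mul_sum]
  exact Finset.sum_congr rfl fun s _ => by ring

theorem wInner_sub_left (x y z : ι → E) : wInner p (x - y) z = wInner p x z - wInner p y z := by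
  simp only [wInner, Pi.sub_apply, inner_sub_left, mul_sub, Finset.sum_sub_distrib]

theorem wInner_add_right (x y z : ι → E) : wInner p x (y + z) = wInner p x y + wInner p x z := by
  simp only [wInner_comm x, wInner_add_left]

theorem wInner_smul_right (c : ℝ) (x z : ι → E) : wInner p x (c • z) = c * wInner p x z := by
  simp only [wInner_comm x, wInner_smul_left]

theorem wInner_sub_right (x y z : ι → E) : wInner p x (y - z) = wInner p x y - wInner p x z := by
  simp only [wInner_comm x, wInner_sub_left]

theorem wInner_self_nonneg (hp : ∀ s, 0 < p s) (x : ι → E) : 0 ≤ wInner p x x :=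
  Finset.sum_nonneg fun s _ => mul_nonneg (hp s).le real_inner_self_nonneg

theorem wInner_zero_left (x : ι → E) : wInner p 0 x = 0 := by
  simp [wInner]

theorem mul_norm_sq_le_wInner_self (hp : ∀ s, 0 < p s) (x : ι → E) (s : ι) :
    p s * ‖x s‖ ^ 2 ≤ wInner p x x := by
  rw [← real_inner_self_eq_norm_sq]
  exact Finset.single_le_sum (f := fun s => p s * ⟪x s, x s⟫)
    (fun s _ => mul_nonneg (hp s).le real_inner_self_nonneg) (Finset.mem_univ s)

theorem continuous_wInner_self : Continuous fun x : ι → E => wInner p x x := by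
  unfold wInner
  fun_prop

/-- Young's inequality for the weighted inner product. -/
theorem two_mul_wInner_le (hp : ∀ s, 0 < p s) {a : ℝ} (ha : 0 < a) (x y : ι → E) :
    2 * wInner p x y ≤ a * wInner p x x + a⁻¹ * wInner p y y := by
  have h := wInner_self_nonneg hp (a • x - y)
  simp only [wInner_sub_left, wInner_sub_right, wInner_smul_left, wInner_smul_right,
    wInner_comm y x] at h
  refine le_of_mul_le_mul_left ?_ ha
  have : a * (a⁻¹ * wInner p y y) = wInner p y y := mul_inv_cancel_left₀ ha.ne' _
  linarith

theorem wInner_sub_self_le (hp : ∀ s, 0 < p s) (x y : ι → E) :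
    wInner p (x - y) (x - y) ≤ 2 * wInner p x x + 2 * wInner p y y := by
  have h := wInner_self_nonneg hp (x + y)
  simp only [wInner_sub_left, wInner_sub_right, wInner_add_left, wInner_add_right,
    wInner_comm y x] at h ⊢
  linarith

theorem wInner_single_left [DecidableEq ι] (s : ι) (v : E) (y : ι → E) :
    wInner p (Pi.single s v) y = p s * ⟪v, y s⟫ := by
  rw [wInner, Finset.sum_eq_single s]
  · simp
  · intro t _ h
    simp [h]
  · simp

/-- Convergence in the weighted norm is convergence. -/
theorem tendsto_zero_of_wInner_self (hp : ∀ s, 0 < p s) {α : Type*} {l : Filter α}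
    {x : α → ι → E} (h : Tendsto (fun k => wInner p (x k) (x k)) l (𝓝 0)) :
    Tendsto x l (𝓝 0) := by
  rw [tendsto_pi_nhds]
  intro s
  have h1 : Tendsto (fun k => ‖x k s‖ ^ 2) l (𝓝 0) := by
    have h2 : Tendsto (fun k => (p s)⁻¹ * wInner p (x k) (x k)) l (𝓝 0) := by
      simpa using h.const_mul (p s)⁻¹
    refine squeeze_zero (fun k => by positivity) (fun k => ?_) h2
    rw [inv_mul_eq_div, le_div_iff₀' (hp s)]
    exact mul_norm_sq_le_wInner_self hp (x k) s
  have h3 := h1.sqrt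
  simp only [Real.sqrt_zero, Real.sqrt_sq (norm_nonneg _)] at h3
  exact tendsto_zero_iff_norm_tendsto_zero.2 h3

/-- Half-cocoercivity of an operator for the weighted inner product: `I - G` is nonexpansive. -/
def Cocoercive (p : ι → ℝ) (G : (ι → E) → ι → E) : Prop :=
  ∀ x y, wInner p (G x - G y) (G x - G y) ≤ 2 * wInner p (x - y) (G x - G y)

/-- Young's inequality with parameter `2` absorbs half of the left side of cocoercivity, so `G` is
2-Lipschitz for the weighted norm. -/
theorem Cocoercive.wInner_sub_le (hp : ∀ s, 0 < p s) {G : (ι → E) → ι → E}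
    (hG : Cocoercive p G) (x y : ι → E) :
    wInner p (G x - G y) (G x - G y) ≤ 4 * wInner p (x - y) (x - y) := by
  have h1 := two_mul_wInner_le hp (a := 2) two_pos (x - y) (G x - G y)
  have h2 := hG x y
  have h3 := wInner_self_nonneg hp (G x - G y)
  norm_num at h1
  linarith

theorem Cocoercive.continuous (hp : ∀ s, 0 < p s) {G : (ι → E) → ι → E}
    (hG : Cocoercive p G) : Continuous G := by
  rw [continuous_iff_continuousAt]
  intro x
  have h1 : Tendsto (fun y => 4 * wInner p (y - x) (y - x)) (𝓝 x) (𝓝 0) := by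
    have h : Continuous fun y => 4 * wInner p (y - x) (y - x) :=
      continuous_const.mul (continuous_wInner_self.comp (continuous_id.sub continuous_const))
    have := h.tendsto x
    simpa [wInner_zero_left] using this
  have h2 : Tendsto (fun y => wInner p (G y - G x) (G y - G x)) (𝓝 x) (𝓝 0) :=
    squeeze_zero (fun y => wInner_self_nonneg hp _) (fun y => hG.wInner_sub_le hp y x) h1
  exact tendsto_sub_nhds_zero_iff.1 (tendsto_zero_of_wInner_self hp h2)

end WeightedInner

/-! ### Bundle averages and the Douglas–Rachford operator -/

namespace Problem

open scoped RealInnerProductSpace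

variable {S T : ℕ} {n : Fin T → ℕ} {Ξ : Fin (T - 1) → Type*} (D : Problem S T n Ξ)

theorem mem_bundle {t : Fin T} {s σ : Fin S} : σ ∈ D.bundle t s ↔ D.Indist t s σ := by
  simp [bundle]

theorem mem_bundle_self (t : Fin T) (s : Fin S) : s ∈ D.bundle t s :=
  D.mem_bundle.2 fun _ _ => rfl

theorem mem_bundle_comm {t : Fin T} {s σ : Fin S} : σ ∈ D.bundle t s ↔ s ∈ D.bundle t σ := by
  simp only [mem_bundle]
  exact ⟨fun h r hr => (h r hr).symm, fun h r hr => (h r hr).symm⟩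

variable {D} in
theorem Indist.bundle_eq {t : Fin T} {s σ : Fin S} (h : D.Indist t s σ) :
    D.bundle t s = D.bundle t σ := by
  ext a
  simp only [mem_bundle]
  exact ⟨fun h' r hr => (h r hr).symm.trans (h' r hr), fun h' r hr => (h r hr).trans (h' r hr)⟩

theorem proj_apply (z : Decision S n) (s : Fin S) (a : Σ t : Fin T, Fin (n t)) :
    D.proj z s a = (∑ σ ∈ D.bundle a.1 s, D.p σ)⁻¹ * ∑ σ ∈ D.bundle a.1 s, D.p σ * z σ a := rfl

theorem proj_mem (z : Decision S n) : D.proj z ∈ D.nonant := by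
  intro s s' t h i
  rw [proj_apply, proj_apply, h.bundle_eq]

theorem proj_sub (x y : Decision S n) : D.proj (x - y) = D.proj x - D.proj y := by
  ext s a
  simp only [proj_apply, Pi.sub_apply, PiLp.sub_apply, mul_sub, Finset.sum_sub_distrib]

theorem continuous_proj : Continuous D.proj := by
  refine continuous_pi fun s => ?_
  refine (PiLp.continuous_toLp 2 _).comp (continuous_pi fun a => ?_)
  fun_prop

variable {D}

theorem Assumptions.proj_eq_self (hD : D.Assumptions) {x : Decision S n} (hx : x ∈ D.nonant) :
    D.proj x = x := by
  ext s a
  have h : ∀ σ ∈ D.bundle a.1 s, D.p σ * x σ a = D.p σ * x s a := fun σ hσ => by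
    rw [hx s σ a.1 (D.mem_bundle.1 hσ) a.2]
  have hpos : 0 < ∑ σ ∈ D.bundle a.1 s, D.p σ :=
    Finset.sum_pos (fun σ _ => hD.p_pos σ) ⟨s, D.mem_bundle_self _ _⟩
  rw [proj_apply, Finset.sum_congr rfl h, ← Finset.sum_mul, inv_mul_cancel_left₀ hpos.ne']

/-- The bundle average is the orthogonal projection on the non-anticipativity subspace. -/
theorem Assumptions.wInner_proj (hD : D.Assumptions) (z : Decision S n) {x : Decision S n}
    (hx : x ∈ D.nonant) : wInner D.p (D.proj z) x = wInner D.p z x := by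
  have hin : ∀ y : Decision S n, wInner D.p y x
      = ∑ a : (Σ t : Fin T, Fin (n t)), ∑ s, D.p s * (y s a * x s a) := by
    intro y
    rw [Finset.sum_comm]
    refine Finset.sum_congr rfl fun s _ => ?_
    rw [PiLp.inner_apply, Finset.mul_sum]
    refine Finset.sum_congr rfl fun a _ => ?_
    rw [real_inner_comm]
    rfl
  rw [hin, hin]
  refine Finset.sum_congr rfl fun a _ => ?_
  set B : Fin S → ℝ := fun s => ∑ σ ∈ D.bundle a.1 s, D.p σ with hB
  have hpos : ∀ s, 0 < B s := fun s =>
    Finset.sum_pos (fun σ _ => hD.p_pos σ) ⟨s, D.mem_bundle_self _ _⟩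
  calc ∑ s, D.p s * (D.proj z s a * x s a)
      = ∑ s, ∑ σ ∈ D.bundle a.1 s, D.p s * ((B s)⁻¹ * (D.p σ * z σ a) * x s a) := by
        refine Finset.sum_congr rfl fun s _ => ?_
        rw [proj_apply, Finset.mul_sum, Finset.sum_mul, Finset.mul_sum]
    -- Bundles are equivalence classes: the double sum is symmetric, and both `B` and `x` are
    -- constant on each class.
    _ = ∑ σ, ∑ s ∈ D.bundle a.1 σ, D.p s * ((B s)⁻¹ * (D.p σ * z σ a) * x s a) := by
        refine Finset.sum_comm' fun s σ => ?_
        simp [D.mem_bundle_comm (s := s) (σ := σ)]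
    _ = ∑ σ, ∑ s ∈ D.bundle a.1 σ, D.p s * ((B σ)⁻¹ * (D.p σ * z σ a) * x σ a) := by
        refine Finset.sum_congr rfl fun σ _ => Finset.sum_congr rfl fun s hs => ?_
        have h := D.mem_bundle.1 hs
        rw [hx σ s a.1 h a.2]
        simp only [hB, h.bundle_eq]
    _ = ∑ σ, D.p σ * (z σ a * x σ a) := by
        refine Finset.sum_congr rfl fun σ _ => ?_
        rw [← Finset.sum_mul]
        change B σ * _ = _
        have := (hpos σ).ne'
        field_simp

variable (D) in
/-- The operator `I - R`, where `R` is the composition of the reflections of the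
Douglas-Rachford splitting. -/
noncomputable def drOp (μ : ℝ) (z : Decision S n) : Decision S n := fun s =>
  (2 : ℝ) • (D.proj z s - proxArgmin (D.f s) μ ((2 : ℝ) • D.proj z s - z s))

/-- With `d = x - y`, `a = Πd` and `b` the difference of the proximal points, the claim is `‖a - b‖²
≤ ⟪d, a - b⟫`. It follows from firm nonexpansiveness, `0 ≤ ⟪b, 2a - d - b⟫`, and from `‖a‖² = ⟪d,
a⟫`. The multiplier serves only to supply affine minorants, hence existence of proximal points. -/
theorem Assumptions.cocoercive_drOp (hD : D.Assumptions) {μ : ℝ} (hμ : 0 < μ) :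
    Cocoercive D.p (D.drOp μ) := by
  intro x y
  obtain ⟨x₁, u, -, hu, -⟩ := hD.exists_multiplier
  set X : Decision S n := fun s => proxArgmin (D.f s) μ ((2 : ℝ) • D.proj x s - x s)
  set Y : Decision S n := fun s => proxArgmin (D.f s) μ ((2 : ℝ) • D.proj y s - y s)
  have hx : D.drOp μ x = (2 : ℝ) • (D.proj x - X) := rfl
  have hy : D.drOp μ y = (2 : ℝ) • (D.proj y - Y) := rfl
  have hfirm : 0 ≤ wInner D.p (X - Y)
      (((2 : ℝ) • D.proj (x - y) - (x - y)) - (X - Y)) := by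
    refine Finset.sum_nonneg fun s _ => mul_nonneg (hD.p_pos s).le ?_
    have h := (hu s).proxArgmin_firm (hD.convex s) (hD.proper s) (hD.lsc s) hμ
      ((2 : ℝ) • D.proj x s - x s) ((2 : ℝ) • D.proj y s - y s)
    rw [proj_sub]
    change 0 ≤ ⟪X s - Y s, (2 : ℝ) • (D.proj x s - D.proj y s) - (x s - y s) - (X s - Y s)⟫
    have e : (2 : ℝ) • (D.proj x s - D.proj y s) - (x s - y s)
        = (2 : ℝ) • D.proj x s - x s - ((2 : ℝ) • D.proj y s - y s) := by
      rw [smul_sub, sub_sub_sub_comm]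
    rw [e]
    exact h
  have horth := hD.wInner_proj (x - y) (D.proj_mem (x - y))
  have e : D.drOp μ x - D.drOp μ y = (2 : ℝ) • (D.proj (x - y) - (X - Y)) := by
    rw [hx, hy, proj_sub, ← smul_sub]; congr 1; abel
  rw [e]
  set a := D.proj (x - y)
  set b := X - Y
  set d := x - y
  simp only [wInner_sub_left, wInner_sub_right, wInner_smul_left, wInner_smul_right,
    wInner_comm d b, wInner_comm a b, wInner_comm d a] at hfirm horth ⊢
  linarith

/-- The zero is `x - μ u` for a solution `x` with multiplier `u`: since `u` averages to zero, the
projection is `x`, the reflected point is `x + μ u`, and its proximal point is `x` again. -/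
theorem Assumptions.exists_drOp_eq_zero (hD : D.Assumptions) {μ : ℝ} (hμ : 0 < μ) :
    ∃ z, D.drOp μ z = 0 := by
  obtain ⟨x, u, hx, hu, horth⟩ := hD.exists_multiplier
  have hproj : D.proj u = 0 := by
    have h1 : wInner D.p (D.proj u) (D.proj u) = 0 := by
      rw [hD.wInner_proj u (D.proj_mem u)]
      exact horth _ (D.proj_mem u)
    ext1 s
    have h2 := mul_norm_sq_le_wInner_self hD.p_pos (D.proj u) s
    rw [h1] at h2
    have h3 : ‖D.proj u s‖ ^ 2 = 0 :=
      le_antisymm (nonpos_of_mul_nonpos_right h2 (hD.p_pos s)) (by positivity)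
    simpa using h3
  have hsmul : D.proj (μ • u) = 0 := by
    ext s a
    have h := congrFun hproj s
    have h' : D.proj u s a = 0 := by rw [h]; rfl
    rw [proj_apply] at h' ⊢
    simp only [Pi.smul_apply, PiLp.smul_apply, smul_eq_mul, mul_left_comm _ μ, ← Finset.mul_sum,
      h', mul_zero, Pi.zero_apply, PiLp.zero_apply]
  have hz : D.proj (x - μ • u) = x := by
    rw [proj_sub, hsmul, hD.proj_eq_self hx, sub_zero]
  refine ⟨x - μ • u, ?_⟩
  ext1 s
  have e : (2 : ℝ) • x s - (x - μ • u) s = x s + μ • u s := by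
    simp only [Pi.sub_apply, Pi.smul_apply, two_smul]; abel
  rw [drOp, hz, e, (hu s).proxArgmin_eq (hD.convex s) (hD.proper s) (hD.lsc s) hμ]
  simp

/-- At a zero, `Πz` is its own proximal point, so `(Πz - z)/μ` is a subgradient in each row. It is
orthogonal to `𝒲`, so the linear terms vanish when the subgradient inequalities are summed over a
competitor in `𝒲`. -/
theorem Assumptions.proj_mem_solutions (hD : D.Assumptions) {μ : ℝ} (hμ : 0 < μ)
    {z : Decision S n} (hz : D.drOp μ z = 0) : D.proj z ∈ D.solutions := by
  obtain ⟨x₁, u, -, hu, -⟩ := hD.exists_multiplier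
  set x := D.proj z with hx
  have hsub : ∀ s, IsSubgrad (D.f s) (x s) ((1 / μ) • (x s - z s)) := by
    intro s
    have h1 := (hu s).isSubgrad_proxArgmin (hD.convex s) (hD.proper s) (hD.lsc s) hμ
      ((2 : ℝ) • x s - z s)
    have h2 : proxArgmin (D.f s) μ ((2 : ℝ) • x s - z s) = x s := by
      have h3 : (2 : ℝ) • (x s - proxArgmin (D.f s) μ ((2 : ℝ) • x s - z s)) = 0 := congrFun hz s
      exact (sub_eq_zero.1 ((smul_eq_zero.1 h3).resolve_left two_ne_zero)).symm
    rw [h2] at h1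
    convert h1 using 2
    rw [two_smul]; abel
  refine ⟨D.proj_mem z, fun y hy => ?_⟩
  by_cases hyd : y ∈ D.dom
  · choose r hr hle using hsub
    rw [objective_eq_coe hr, hD.objective_eq hyd, EReal.coe_le_coe_iff]
    have h1 : ∀ s, r s + ⟪(1 / μ) • (x s - z s), y s - x s⟫ ≤ (D.f s (y s)).toReal := by
      intro s
      have := EReal.toReal_le_toReal (hle s (y s)) (EReal.coe_ne_bot _) (hD.mem_dom_iff.1 hyd s)
      rwa [EReal.toReal_coe] at this
    have h2 : ∑ s, D.p s * ⟪(1 / μ) • (x s - z s), y s - x s⟫ = 0 := by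
      have h3 : wInner D.p ((1 / μ) • (x - z)) (y - x) = 0 := by
        rw [wInner_smul_left, wInner_sub_left, hx,
          hD.wInner_proj z (sub_mem hy (D.proj_mem z)), sub_self, mul_zero]
      exact h3
    calc ∑ s, D.p s * r s
        = ∑ s, D.p s * (r s + ⟪(1 / μ) • (x s - z s), y s - x s⟫) := by
          simp only [mul_add, Finset.sum_add_distrib, h2, add_zero]
      _ ≤ _ := Finset.sum_le_sum fun s _ => mul_le_mul_of_nonneg_left (h1 s) (hD.p_pos s).le
  · have : D.objective y = ⊤ := by
      by_contra h
      exact hyd (lt_top_iff_ne_top.2 h)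
    rw [this]; exact le_top

end Problem

/-! ### Expected decrease of a delayed coordinate step -/

section Decrease

open scoped RealInnerProductSpace

variable {ι E : Type*} [Fintype ι] [DecidableEq ι] [NormedAddCommGroup E] [InnerProductSpace ℝ E]
  {p : ι → ℝ}

/-- One coordinate step with stepsize `h / q_s` in the coordinate `s` and direction `g`. -/
noncomputable def coordStep (q : ι → ℝ) (h : ℝ) (z g : ι → E) (s : ι) : ι → E :=
  z - Pi.single s ((h / q s) • g s)

/-- The factor `q s` cancels the `1 / q s` of the step in the linear term, so that summing over `s`
recovers the full inner product with `g`. -/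
theorem wInner_coordStep_sub {q : ι → ℝ} (hq : ∀ s, 0 < q s) (h : ℝ) (z g v : ι → E) (s : ι) :
    q s * wInner p (coordStep q h z g s - v) (coordStep q h z g s - v)
      = q s * wInner p (z - v) (z - v) - 2 * h * (p s * ⟪(z - v) s, g s⟫)
        + h ^ 2 / q s * (p s * ⟪g s, g s⟫) := by
  have e : coordStep q h z g s - v = (z - v) - Pi.single s ((h / q s) • g s) := by
    rw [coordStep]; abel
  rw [e]
  generalize z - v = x
  rw [wInner_sub_left, wInner_sub_right, wInner_sub_right,
    wInner_comm x (Pi.single s _), wInner_single_left, wInner_single_left, Pi.single_eq_same,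
    real_inner_smul_left, real_inner_smul_left, real_inner_smul_right, real_inner_comm]
  have := (hq s).ne'
  field_simp
  ring

theorem wInner_coordStep_sub_self {q : ι → ℝ} (h : ℝ) (z g : ι → E)
    (s : ι) : wInner p (coordStep q h z g s - z) (coordStep q h z g s - z)
      = (h / q s) ^ 2 * (p s * ‖g s‖ ^ 2) := by
  have e : coordStep q h z g s - z = -Pi.single s ((h / q s) • g s) := by
    rw [coordStep]; abel
  have e2 : -(Pi.single s ((h / q s) • g s) : ι → E) = Pi.single s (-((h / q s) • g s)) := by
    rw [Pi.single_neg]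
  rw [e, e2, wInner_single_left, Pi.single_eq_same, inner_neg_neg, real_inner_smul_left,
    real_inner_smul_right, real_inner_self_eq_norm_sq]
  ring

/-- Expected decrease of the Lyapunov function in one asynchronous coordinate step. -/
theorem Cocoercive.expected_decrease (hp : ∀ s, 0 < p s) {G : (ι → E) → ι → E}
    (hG : Cocoercive p G) {q : ι → ℝ} {β : ℝ} (hβ : 0 < β) (hq : ∀ s, β ^ 2 ≤ q s)
    (hq_sum : ∑ s, q s = 1) {τ k m : ℕ} (hmk : m ≤ k) (hkm : k ≤ m + τ) (hτk : τ ≤ k)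
    {h c : ℝ} (h0 : 0 < h) (hh : h * (2 * τ * β + 1) ≤ c * β ^ 2) (z : ℕ → ι → E)
    {v : ι → E} (hv : G v = 0) :
    ∑ s, q s * (wInner p (coordStep q h (z k) (G (z m)) s - v)
          (coordStep q h (z k) (G (z m)) s - v)
        + β * τ * wInner p (coordStep q h (z k) (G (z m)) s - z k)
          (coordStep q h (z k) (G (z m)) s - z k))
      ≤ wInner p (z k - v) (z k - v)
        + β * ∑ i ∈ Finset.range τ,
          wInner p (z (k - τ + i + 1) - z (k - τ + i)) (z (k - τ + i + 1) - z (k - τ + i))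
        - (1 - c) * h * wInner p (G (z m)) (G (z m)) := by
  have hq0 : ∀ s, 0 < q s := fun s => lt_of_lt_of_le (by positivity) (hq s)
  set g := G (z m) with hg
  set W := wInner p g g with hW
  have hW0 : 0 ≤ W := wInner_self_nonneg hp g
  set Q := ∑ s, h ^ 2 / q s * (p s * ⟪g s, g s⟫) with hQ
  have hQle : Q ≤ h ^ 2 / β ^ 2 * W := by
    rw [hQ, hW, wInner, Finset.mul_sum]
    refine Finset.sum_le_sum fun s _ => mul_le_mul_of_nonneg_right ?_
      (mul_nonneg (hp s).le real_inner_self_nonneg)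
    exact div_le_div_of_nonneg_left (by positivity) (by positivity) (hq s)
  have h1 : ∑ s, q s * wInner p (coordStep q h (z k) g s - v) (coordStep q h (z k) g s - v)
      = wInner p (z k - v) (z k - v) - 2 * h * wInner p (z k - v) g + Q := by
    simp only [wInner_coordStep_sub hq0, Finset.sum_add_distrib, Finset.sum_sub_distrib,
      ← Finset.sum_mul, ← Finset.mul_sum, hq_sum, one_mul, hQ]
    rfl
  have h2 : ∑ s, q s * wInner p (coordStep q h (z k) g s - z k) (coordStep q h (z k) g s - z k)
      = Q := by
    simp only [wInner_coordStep_sub hq0, sub_self, wInner_zero_left, Pi.zero_apply,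
      inner_zero_left, mul_zero, zero_add, hQ]
  have h3 : ∑ s, q s * (wInner p (coordStep q h (z k) g s - v) (coordStep q h (z k) g s - v)
        + β * τ * wInner p (coordStep q h (z k) g s - z k) (coordStep q h (z k) g s - z k))
      = wInner p (z k - v) (z k - v) - 2 * h * wInner p (z k - v) g + Q + β * τ * Q := by
    rw [← h1]
    conv_rhs => rw [← h2]
    rw [Finset.mul_sum, ← Finset.sum_add_distrib]
    exact Finset.sum_congr rfl fun s _ => by ring
  rw [h3]
  set Δ : ℕ → ι → E := fun i => z (i + 1) - z i with hΔ
  -- Cocoercivity is available only at the point `z m` where `g` was computed; the rest of the path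
  -- from `z m` to `z k` is the error due to the delay.
  have h4 : wInner p (z k - v) g = wInner p (z m - v) g + ∑ i ∈ Finset.Ico m k, wInner p (Δ i) g := by
    have e : z k - v = (z m - v) + (z k - z m) := by abel
    rw [e, wInner_add_left]
    simp only [hΔ, wInner_sub_left]
    rw [Finset.sum_Ico_sub (fun i => wInner p (z i) g) hmk]
  have h5 : W ≤ 2 * wInner p (z m - v) g := by
    have := hG (z m) v
    rwa [hv, sub_zero] at this
  have h6 : ∀ i, -(2 * h * wInner p (Δ i) g) ≤ β * wInner p (Δ i) (Δ i) + β⁻¹ * (h ^ 2 * W) := by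
    intro i
    have := two_mul_wInner_le hp hβ (Δ i) ((-h) • g)
    simp only [wInner_smul_right, wInner_smul_left] at this
    rw [hW]
    linarith
  have h7 : -(2 * h * ∑ i ∈ Finset.Ico m k, wInner p (Δ i) g)
      ≤ β * ∑ i ∈ Finset.range τ, wInner p (Δ (k - τ + i)) (Δ (k - τ + i))
        + τ * (β⁻¹ * (h ^ 2 * W)) := by
    have hsub : Finset.Ico m k ⊆ Finset.Ico (k - τ) k :=
      Finset.Ico_subset_Ico (by omega) le_rfl
    have hr : ∀ f : ℕ → ℝ, ∑ i ∈ Finset.range τ, f (k - τ + i) = ∑ i ∈ Finset.Ico (k - τ) k, f i := by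
      intro f
      rw [Finset.sum_Ico_eq_sum_range]
      congr 2
      omega
    rw [hr fun i => wInner p (Δ i) (Δ i)]
    calc -(2 * h * ∑ i ∈ Finset.Ico m k, wInner p (Δ i) g)
        = ∑ i ∈ Finset.Ico m k, -(2 * h * wInner p (Δ i) g) := by
          rw [Finset.mul_sum, Finset.sum_neg_distrib]
      _ ≤ ∑ i ∈ Finset.Ico m k, (β * wInner p (Δ i) (Δ i) + β⁻¹ * (h ^ 2 * W)) :=
          Finset.sum_le_sum fun i _ => h6 i
      _ ≤ ∑ i ∈ Finset.Ico (k - τ) k, (β * wInner p (Δ i) (Δ i) + β⁻¹ * (h ^ 2 * W)) :=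
          Finset.sum_le_sum_of_subset_of_nonneg hsub fun i _ _ =>
            add_nonneg (mul_nonneg hβ.le (wInner_self_nonneg hp _)) (by positivity)
      _ = _ := by
          rw [Finset.sum_add_distrib, ← Finset.mul_sum, Finset.sum_const, Nat.card_Ico,
            nsmul_eq_mul, Nat.sub_sub_self hτk]
  -- The stepsize bound comes from here: the Young remainders and the second-order terms each
  -- contribute `τβ`, and together they give the factor `2τβ + 1`.
  have h8 : τ * (β⁻¹ * (h ^ 2 * W)) + (1 + β * τ) * (h ^ 2 / β ^ 2 * W) ≤ c * h * W := by
    have e : τ * (β⁻¹ * (h ^ 2 * W)) + (1 + β * τ) * (h ^ 2 / β ^ 2 * W)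
        = h * W / β ^ 2 * (h * (2 * τ * β + 1)) := by
      field_simp
      ring
    rw [e]
    calc h * W / β ^ 2 * (h * (2 * τ * β + 1)) ≤ h * W / β ^ 2 * (c * β ^ 2) :=
          mul_le_mul_of_nonneg_left hh (by positivity)
      _ = c * h * W := by field_simp
  have h9 : (1 + β * τ) * Q ≤ (1 + β * τ) * (h ^ 2 / β ^ 2 * W) :=
    mul_le_mul_of_nonneg_left hQle (by positivity)
  have h10 : h * W ≤ 2 * h * wInner p (z m - v) g := by
    have := mul_le_mul_of_nonneg_left h5 h0.le
    linarith
  rw [h4]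
  simp only [hΔ] at h7 ⊢
  linarith

end Decrease

/-! ### Almost supermartingale convergence -/

section Supermartingale

variable {Ω : Type*} {m₀ : MeasurableSpace Ω} {P : Measure Ω} [IsFiniteMeasure P]

/-- A version of the Robbins-Siegmund theorem. -/
theorem ae_tendsto_and_summable_of_drift {ℱ : Filtration ℕ m₀} {V U : ℕ → Ω → ℝ}
    (hV0 : ∀ k ω, 0 ≤ V k ω) (hU0 : ∀ k ω, 0 ≤ U k ω)
    (hVm : ∀ k, StronglyMeasurable[ℱ k] (V k)) (hUm : ∀ k, StronglyMeasurable[ℱ k] (U k))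
    (hVi : ∀ k, Integrable (V k) P) (hUi : ∀ k, Integrable (U k) P)
    (hdrift : ∀ k A, MeasurableSet[ℱ k] A →
      ∫ ω in A, (V (k + 1) ω + U k ω) ∂P ≤ ∫ ω in A, V k ω ∂P) :
    ∀ᵐ ω ∂P, (∃ c, Tendsto (fun k => V k ω) atTop (𝓝 c)) ∧ Summable fun k => U k ω := by
  -- Adding the accumulated decrease turns the drift inequality into the submartingale property of
  -- `Y`. As `Y ≤ 0`, its `L¹` norm is at most that of `Y 0`.
  set Y : ℕ → Ω → ℝ := fun k ω => -(V k ω + ∑ j ∈ Finset.range k, U j ω) with hY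
  have hsumi : ∀ k, Integrable (fun ω => ∑ j ∈ Finset.range k, U j ω) P := fun k =>
    integrable_finsetSum _ fun j _ => hUi j
  have hYi : ∀ k, Integrable (Y k) P := fun k => ((hVi k).add (hsumi k)).neg
  have hsub : Submartingale Y ℱ P := by
    refine submartingale_of_setIntegral_le_succ (fun k => ?_) hYi fun k A hA => ?_
    · refine ((hVm k).add ?_).neg
      refine Finset.stronglyMeasurable_fun_sum _ fun j hj => ?_
      exact (hUm j).mono (ℱ.mono (Finset.mem_range.1 hj).le)
    · simp only [hY, integral_neg, neg_le_neg_iff]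
      rw [integral_add (hVi k).integrableOn (hsumi k).integrableOn]
      have e : ∀ ω, V (k + 1) ω + ∑ j ∈ Finset.range (k + 1), U j ω
          = (V (k + 1) ω + U k ω) + ∑ j ∈ Finset.range k, U j ω := fun ω => by
        rw [Finset.sum_range_succ]; ring
      simp only [e]
      rw [integral_add (f := fun ω => V (k + 1) ω + U k ω) ((hVi _).add (hUi k)).integrableOn
        (hsumi k).integrableOn]
      linarith [hdrift k A hA]
  have hbdd : ∀ k, eLpNorm (Y k) 1 P ≤ ((-∫ ω, Y 0 ω ∂P).toNNReal : ENNReal) := by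
    intro k
    have h1 : ∫ ω, Y 0 ω ∂P ≤ ∫ ω, Y k ω ∂P := by
      have := hsub.setIntegral_le (Nat.zero_le k) (s := Set.univ) MeasurableSet.univ
      simpa using this
    have h2 : ∀ ω, Y k ω ≤ 0 := fun ω =>
      neg_nonpos.2 (add_nonneg (hV0 k ω) (Finset.sum_nonneg fun j _ => hU0 j ω))
    rw [eLpNorm_one_eq_lintegral_enorm, ← ofReal_integral_norm_eq_lintegral_enorm (hYi k)]
    refine ENNReal.ofReal_le_ofReal ?_
    have h3 : ∫ ω, ‖Y k ω‖ ∂P = -∫ ω, Y k ω ∂P := by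
      rw [← integral_neg]
      exact integral_congr_ae (Eventually.of_forall fun ω => by
        simp only [Real.norm_eq_abs, abs_of_nonpos (h2 ω)])
    rw [h3]
    linarith
  filter_upwards [hsub.exists_ae_tendsto_of_bdd hbdd] with ω hω
  obtain ⟨c, hc⟩ := hω
  have hsm : Summable fun k => U k ω := by
    obtain ⟨b, hb⟩ := hc.bddBelow_range
    refine summable_of_sum_range_le (c := -b) (fun k => hU0 k ω) fun k => ?_
    have h1 : b ≤ Y k ω := hb ⟨k, rfl⟩
    have h2 := hV0 k ω
    simp only [hY] at h1
    linarith
  refine ⟨⟨-c - ∑' k, U k ω, ?_⟩, hsm⟩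
  have := hc.neg.sub hsm.hasSum.tendsto_sum_nat
  refine this.congr fun k => ?_
  simp [hY]

end Supermartingale

/-! ### Functions of a finite-valued variable -/

section FiniteFactor

variable {Ω κ : Type*} {H : Ω → κ}

/-- Every subset of the finite space `κ` is measurable, so measurability needs no regularity of `f`;
in particular none of the proximal maps. -/
theorem measurable_comap_of_factorsThrough [Finite κ] [MeasurableSpace κ]
    [MeasurableSingletonClass κ] {X : Type*} [MeasurableSpace X] {f : Ω → X}
    (hf : f.FactorsThrough H) : Measurable[MeasurableSpace.comap H inferInstance] f := by
  refine fun B _ => ⟨H '' (f ⁻¹' B), (Set.toFinite _).measurableSet, ?_⟩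
  ext ω
  constructor
  · rintro ⟨ω', hω', e⟩
    have : f ω' = f ω := hf e
    rw [Set.mem_preimage, ← this]
    exact hω'
  · exact fun hω => ⟨ω, hω, rfl⟩

variable [MeasurableSpace Ω] {P : Measure Ω}

theorem integrable_of_factorsThrough [IsFiniteMeasure P] [Fintype κ] [MeasurableSpace κ]
    [MeasurableSingletonClass κ] (hH : Measurable H) {f : Ω → ℝ} (hf : f.FactorsThrough H) : Integrable f P := by
  have hm : Measurable f := (measurable_comap_of_factorsThrough hf).mono hH.comap_le le_rfl
  refine Integrable.of_bound hm.aestronglyMeasurable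
    (∑ a, ‖Function.extend H f 0 a‖) (Eventually.of_forall fun ω => ?_)
  rw [← hf.extend_apply 0 ω]
  exact Finset.single_le_sum (f := fun a => ‖Function.extend H f 0 a‖)
    (fun a _ => norm_nonneg _) (Finset.mem_univ (H ω))

/-- Integrals over the sets of a finite σ-algebra can be compared on its atoms. -/
theorem setIntegral_le_of_atoms [Fintype κ] [MeasurableSpace κ] [MeasurableSingletonClass κ]
    (hH : Measurable H) {f g : Ω → ℝ} (hf : Integrable f P) (hg : Integrable g P)
    (hfg : ∀ ω, P (H ⁻¹' {H ω}) ≠ 0 → ∫ x in H ⁻¹' {H ω}, f x ∂P ≤ ∫ x in H ⁻¹' {H ω}, g x ∂P)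
    {A : Set Ω} (hA : MeasurableSet[MeasurableSpace.comap H inferInstance] A) :
    ∫ x in A, f x ∂P ≤ ∫ x in A, g x ∂P := by
  classical
  obtain ⟨B, -, rfl⟩ := hA
  have e : H ⁻¹' B = ⋃ a ∈ B.toFinite.toFinset, H ⁻¹' {a} := by
    ext ω; simp
  have hms : ∀ a ∈ B.toFinite.toFinset, MeasurableSet (H ⁻¹' {a}) := fun a _ =>
    hH (measurableSet_singleton a)
  have hdisj : (B.toFinite.toFinset : Set κ).Pairwise
      (Function.onFun Disjoint fun a => H ⁻¹' {a}) := fun a _ b _ hab =>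
    Disjoint.preimage _ (by simpa using hab)
  rw [e, integral_biUnion_finset _ hms hdisj fun a _ => hf.integrableOn,
    integral_biUnion_finset _ hms hdisj fun a _ => hg.integrableOn]
  refine Finset.sum_le_sum fun a _ => ?_
  by_cases h0 : P (H ⁻¹' {a}) = 0
  · rw [Measure.restrict_eq_zero.2 h0, integral_zero_measure, integral_zero_measure]
  · obtain ⟨ω, hω⟩ := nonempty_of_measure_ne_zero h0
    have : H ω = a := hω
    subst this
    exact hfg ω h0

theorem setIntegral_comp_eq_sum [IsFiniteMeasure P] [Fintype κ] [MeasurableSpace κ]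
    [MeasurableSingletonClass κ] {u : Ω → κ} (hu : Measurable u) (A : Set Ω)
    (Φ : κ → ℝ) : ∫ ω in A, Φ (u ω) ∂P = ∑ s, P.real (A ∩ u ⁻¹' {s}) * Φ s := by
  classical
  have e : ∀ ω, Φ (u ω) = ∑ s, (u ⁻¹' {s}).indicator (fun _ => Φ s) ω := by
    intro ω
    rw [Finset.sum_eq_single (u ω)]
    · simp
    · intro s _ hs
      rw [Set.indicator_of_notMem]
      exact fun h => hs h.symm
    · simp
  simp only [e]
  have hms : ∀ s, MeasurableSet (u ⁻¹' {s}) := fun s => hu (measurableSet_singleton s)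
  rw [integral_finsetSum _ fun s _ => (integrable_const (Φ s)).indicator (hms s)]
  refine Finset.sum_congr rfl fun s _ => ?_
  rw [setIntegral_indicator (hms s), setIntegral_const, smul_eq_mul]

end FiniteFactor

/-! ### Histories of workers and scenarios -/

section History

variable {Ω : Type*} {M S : ℕ}

/-- The workers that return at the updates `0, …, k` and the scenarios incorporated at the updates
`0, …, k - 1`. -/
def history (w : ℕ → Ω → Fin M) (u : ℕ → Ω → Fin S) (k : ℕ) (ω : Ω) :
    (Fin (k + 1) → Fin M) × (Fin k → Fin S) :=
  (fun j => w j ω, fun j => u j ω)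

variable {w : ℕ → Ω → Fin M} {u : ℕ → Ω → Fin S}

theorem history_eq_iff {k : ℕ} {ω ω' : Ω} : history w u k ω = history w u k ω' ↔
    (∀ j ≤ k, w j ω = w j ω') ∧ ∀ j < k, u j ω = u j ω' := by
  simp only [history, Prod.mk.injEq, funext_iff, Fin.forall_iff, Nat.lt_succ_iff]

theorem measurable_history [MeasurableSpace Ω] (hw : ∀ k, Measurable (w k))
    (hu : ∀ k, Measurable (u k)) (k : ℕ) : Measurable (history w u k) :=
  Measurable.prodMk (f := fun ω (j : Fin (k + 1)) => w j ω) (g := fun ω (j : Fin k) => u j ω)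
    (measurable_pi_lambda _ fun j => hw j) (measurable_pi_lambda _ fun j => hu j)

/-- The filtration generated by the histories, from update `k₀` on. -/
def historyFiltration [MeasurableSpace Ω] (hw : ∀ k, Measurable (w k))
    (hu : ∀ k, Measurable (u k)) (k₀ : ℕ) : Filtration ℕ (‹MeasurableSpace Ω›) where
  seq k := MeasurableSpace.comap (history w u (k + k₀)) inferInstance
  mono' := by
    refine monotone_nat_of_le_succ fun k => Measurable.comap_le ?_
    refine measurable_comap_of_factorsThrough fun ω ω' h => ?_
    rw [history_eq_iff] at h ⊢
    exact ⟨fun j hj => h.1 j (by omega), fun j hj => h.2 j (by omega)⟩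
  le' k := (measurable_history hw hu _).comap_le

end History

/-! ### Opial's argument -/

section Opial

variable {ι E : Type*} [Fintype ι] [NormedAddCommGroup E] [InnerProductSpace ℝ E]
  [FiniteDimensional ℝ E] {p : ι → ℝ}

/-- A sequence whose weighted distances to a dense set of zeros of `G` converge and along which `G`
tends to zero converges to a zero of `G`. -/
theorem exists_tendsto_of_wInner_tendsto (hp : ∀ s, 0 < p s) {G : (ι → E) → ι → E}
    (hG : Continuous G) {z : ℕ → ι → E} (hGz : Tendsto (fun k => G (z k)) atTop (𝓝 0))
    {D : Set (ι → E)} (hD : D.Nonempty) (hdense : {v | G v = 0} ⊆ closure D)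
    (hconv : ∀ v ∈ D, ∃ c, Tendsto (fun k => wInner p (z k - v) (z k - v)) atTop (𝓝 c)) :
    ∃ x, G x = 0 ∧ Tendsto z atTop (𝓝 x) := by
  obtain ⟨v, hv⟩ := hD
  have hbdd : Bornology.IsBounded (Set.range z) := by
    obtain ⟨c, hc⟩ := hconv v hv
    obtain ⟨B, hB⟩ := hc.bddAbove_range
    rw [isBounded_iff_forall_norm_le]
    have hB0 : ∀ k, wInner p (z k - v) (z k - v) ≤ B := fun k => hB ⟨k, rfl⟩
    refine ⟨(∑ s, √(B / p s)) + ‖v‖, ?_⟩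
    rintro _ ⟨k, rfl⟩
    have h1 : ‖z k - v‖ ≤ ∑ s, √(B / p s) := by
      rw [pi_norm_le_iff_of_nonneg (Finset.sum_nonneg fun s _ => Real.sqrt_nonneg _)]
      intro s
      refine le_trans ?_ (Finset.single_le_sum (f := fun s => √(B / p s))
        (fun s _ => Real.sqrt_nonneg _) (Finset.mem_univ s))
      refine Real.le_sqrt_of_sq_le ?_
      rw [le_div_iff₀' (hp s)]
      exact (mul_norm_sq_le_wInner_self hp (z k - v) s).trans (hB0 k)
    have h2 : ‖z k‖ ≤ ‖z k - v‖ + ‖v‖ := by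
      simpa using norm_add_le (z k - v) v
    linarith
  obtain ⟨x, -, φ, hφ, hx⟩ := tendsto_subseq_of_bounded hbdd fun k => Set.mem_range_self k
  have hGx : G x = 0 :=
    tendsto_nhds_unique ((hG.tendsto x).comp hx) (hGz.comp hφ.tendsto_atTop)
  refine ⟨x, hGx, ?_⟩
  rw [← tendsto_sub_nhds_zero_iff]
  refine tendsto_zero_of_wInner_self hp ?_
  rw [Metric.tendsto_atTop]
  intro ε hε
  have hcont : Continuous fun y => wInner p (x - y) (x - y) :=
    continuous_wInner_self.comp (continuous_const.sub continuous_id)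
  have hopen : {y | wInner p (x - y) (x - y) < ε / 4} ∈ 𝓝 x := by
    refine (isOpen_lt hcont continuous_const).mem_nhds ?_
    change wInner p (x - x) (x - x) < ε / 4
    rw [sub_self, wInner_zero_left]
    positivity
  -- Distances to the cluster point `x` are not known to converge, as `x` need not be in `D`.
  -- Distances to a nearby `y ∈ D` do converge, and the subsequence identifies their limit as the
  -- small distance from `x` to `y`.
  obtain ⟨y, hy, hyD⟩ := mem_closure_iff_nhds.1 (hdense hGx) _ hopen
  have hy' : wInner p (x - y) (x - y) < ε / 4 := hy
  obtain ⟨c, hc⟩ := hconv y hyD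
  have hcy : c = wInner p (x - y) (x - y) := by
    have h1 : Continuous fun a => wInner p (a - y) (a - y) :=
      continuous_wInner_self.comp (continuous_id.sub continuous_const)
    exact tendsto_nhds_unique (hc.comp hφ.tendsto_atTop) ((h1.tendsto x).comp hx)
  have hev := hc.eventually (gt_mem_nhds (hcy.trans_lt hy'))
  obtain ⟨N, hN⟩ := eventually_atTop.1 hev
  refine ⟨N, fun k hk => ?_⟩
  have e : z k - x = (z k - y) - (x - y) := by abel
  have h1 := wInner_sub_self_le hp (z k - y) (x - y)
  have h2 := hN k hk
  rw [Real.dist_eq, sub_zero, abs_of_nonneg (wInner_self_nonneg hp _), e]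
  linarith

end Opial

/-! ### Asynchronous coordinate iterations -/

section AsyncIteration

variable {Ω : Type*} [MeasurableSpace Ω] {S M : ℕ} {E : Type*} [NormedAddCommGroup E]
  [InnerProductSpace ℝ E]

/-- A randomized asynchronous coordinate iteration for the operator `G`: at update `k`, the
coordinate `u k` of `z k` is moved along the direction that the worker `w k` computed from
`z (m k)`. -/
structure IsAsyncIteration (P : Measure Ω) (q : Fin S → ℝ) (G : (Fin S → E) → Fin S → E)
    (h : ℕ → ℝ) (τ : ℕ) (w : ℕ → Ω → Fin M) (u : ℕ → Ω → Fin S) (z : ℕ → Ω → Fin S → E)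
    (m : ℕ → Ω → ℕ) : Prop where
  measurable_worker : ∀ k, Measurable (w k)
  measurable_scen : ∀ k, Measurable (u k)
  init : ∀ ω ω', z 0 ω = z 0 ω'
  step : ∀ k ω, z (k + 1) ω = coordStep q (h k) (z k ω) (G (z (m k ω) ω)) (u k ω)
  read_le : ∀ k ω, m k ω ≤ k
  read_congr : ∀ k ω ω', (∀ j ≤ k, w j ω = w j ω') → m k ω = m k ω'
  returned : ∀ k ω, m k ω ≠ 0 → ∃ j < k, w j ω = w k ω
  delay : ∀ᵐ ω ∂P, ∀ k, k ≤ m k ω + τ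
  sampled : SampledFrom P q w u

/-- The Lyapunov function: the squared distance to `v`, and weighted squares of the last steps. -/
noncomputable def lyapunov (p : Fin S → ℝ) (β : ℝ) (τ : ℕ) (v : Fin S → E) (z : ℕ → Fin S → E)
    (k : ℕ) : ℝ :=
  wInner p (z k - v) (z k - v) + β * ∑ i ∈ Finset.range τ, ((i : ℝ) + 1) *
    wInner p (z (k - τ + i + 1) - z (k - τ + i)) (z (k - τ + i + 1) - z (k - τ + i))

variable {p : Fin S → ℝ} {β : ℝ} {τ : ℕ} {v : Fin S → E}

theorem lyapunov_nonneg (hp : ∀ s, 0 < p s) (hβ : 0 < β) (z : ℕ → Fin S → E) (k : ℕ) :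
    0 ≤ lyapunov p β τ v z k :=
  add_nonneg (wInner_self_nonneg hp _) (mul_nonneg hβ.le (Finset.sum_nonneg fun i _ =>
    mul_nonneg (by positivity) (wInner_self_nonneg hp _)))

/-- When the window slides, each old step loses one unit of weight and the newest enters with weight
`τ`. The lost units are the sum of squares that pays for the delay in `expected_decrease`. -/
theorem lyapunov_succ (z : ℕ → Fin S → E) {k : ℕ} (hk : τ ≤ k) :
    lyapunov p β τ v z (k + 1) = wInner p (z (k + 1) - v) (z (k + 1) - v)
      + β * τ * wInner p (z (k + 1) - z k) (z (k + 1) - z k)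
      + β * ∑ i ∈ Finset.range τ, (i : ℝ) *
        wInner p (z (k - τ + i + 1) - z (k - τ + i)) (z (k - τ + i + 1) - z (k - τ + i)) := by
  set e : ℕ → ℝ := fun i => wInner p (z (k - τ + i + 1) - z (k - τ + i))
    (z (k - τ + i + 1) - z (k - τ + i)) with he
  have h1 : ∑ i ∈ Finset.range τ, ((i : ℝ) + 1) *
      wInner p (z (k + 1 - τ + i + 1) - z (k + 1 - τ + i))
        (z (k + 1 - τ + i + 1) - z (k + 1 - τ + i))
      = ∑ i ∈ Finset.range τ, ((i + 1 : ℕ) : ℝ) * e (i + 1) := by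
    refine Finset.sum_congr rfl fun i _ => ?_
    have : k + 1 - τ + i = k - τ + (i + 1) := by omega
    rw [this, Nat.cast_add_one]
  have h2 : ∑ i ∈ Finset.range τ, ((i + 1 : ℕ) : ℝ) * e (i + 1)
      = ∑ i ∈ Finset.range τ, (i : ℝ) * e i + τ * e τ := by
    rw [← Finset.sum_range_succ (fun i => (i : ℝ) * e i), Finset.sum_range_succ']
    simp
  have h3 : e τ = wInner p (z (k + 1) - z k) (z (k + 1) - z k) := by
    simp only [he, Nat.sub_add_cancel hk]
  rw [lyapunov, h1, h2, h3]
  ring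

namespace IsAsyncIteration

variable {P : Measure Ω} {q : Fin S → ℝ} {G : (Fin S → E) → Fin S → E} {h : ℕ → ℝ}
  {w : ℕ → Ω → Fin M} {u : ℕ → Ω → Fin S} {z : ℕ → Ω → Fin S → E} {m : ℕ → Ω → ℕ}

/-- The iterates are functions of the returned workers and of the incorporated scenarios only. All
`j ≤ k` are treated together because a step reads an older iterate. -/
theorem congr (hA : IsAsyncIteration P q G h τ w u z m) {ω ω' : Ω} :
    ∀ k, (∀ j < k, w j ω = w j ω') → (∀ j < k, u j ω = u j ω') →
      ∀ j ≤ k, z j ω = z j ω' := by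
  intro k
  induction k with
  | zero =>
    intro _ _ j hj
    rw [Nat.le_zero.1 hj]
    exact hA.init ω ω'
  | succ k ih =>
    intro hw hu j hj
    have ih' := ih (fun j hj => hw j (by omega)) fun j hj => hu j (by omega)
    rcases Nat.le_succ_iff.1 hj with hj | rfl
    · exact ih' j hj
    · rw [hA.step, hA.step, hA.read_congr k ω ω' fun j hj => hw j (by omega),
        ih' k le_rfl, ih' _ (hA.read_le k ω'), hu k (by omega)]

theorem congr_of_history (hA : IsAsyncIteration P q G h τ w u z m) {k : ℕ} {ω ω' : Ω}
    (hh : history w u k ω = history w u k ω') : ∀ j ≤ k, z j ω = z j ω' := by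
  rw [history_eq_iff] at hh
  exact hA.congr k (fun j hj => hh.1 j hj.le) hh.2

theorem lyapunov_congr (hA : IsAsyncIteration P q G h τ w u z m) {k : ℕ} (hk : τ ≤ k) :
    (fun ω => lyapunov p β τ v (fun j => z j ω) k).FactorsThrough (history w u k) := by
  intro ω ω' hh
  have hz := hA.congr_of_history hh
  simp only [lyapunov]
  rw [hz k le_rfl]
  congr 2
  refine Finset.sum_congr rfl fun i hi => ?_
  have hi := Finset.mem_range.1 hi
  rw [hz (k - τ + i + 1) (by omega), hz (k - τ + i) (by omega)]

theorem direction_congr (hA : IsAsyncIteration P q G h τ w u z m) {k : ℕ} {ω ω' : Ω}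
    (hh : history w u k ω = history w u k ω') : G (z (m k ω) ω) = G (z (m k ω') ω') := by
  rw [hA.read_congr k ω ω' (history_eq_iff.1 hh).1,
    hA.congr_of_history hh _ (hA.read_le k ω')]

variable [IsProbabilityMeasure P]

/-- The drift of the Lyapunov function on the atoms of the history. -/
theorem setIntegral_atom_le (hA : IsAsyncIteration P q G h τ w u z m) (hp : ∀ s, 0 < p s)
    (hG : Cocoercive p G) (hβ : 0 < β) (hq : ∀ s, β ^ 2 ≤ q s) (hq_sum : ∑ s, q s = 1)
    {c h₀ : ℝ} (hc1 : c < 1) (hh₀ : 0 < h₀) (hh : ∀ k, h₀ ≤ h k)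
    (hhc : ∀ k, h k * (2 * τ * β + 1) ≤ c * β ^ 2) (hv : G v = 0) {k : ℕ} (hk : τ + 1 ≤ k)
    (ω₀ : Ω) (hpos : P (history w u k ⁻¹' {history w u k ω₀}) ≠ 0) :
    ∫ ω in history w u k ⁻¹' {history w u k ω₀}, (lyapunov p β τ v (fun j => z j ω) (k + 1)
        + (1 - c) * h₀ * wInner p (G (z (m k ω) ω)) (G (z (m k ω) ω))) ∂P
      ≤ ∫ ω in history w u k ⁻¹' {history w u k ω₀}, lyapunov p β τ v (fun j => z j ω) k ∂P := by
  -- The delay bound holds only almost surely, but an atom of positive measure contains a good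
  -- point, and the iterates up to `k` and the read index are constant on the atom.
  obtain ⟨ω₁, h1, hd⟩ := ((frequently_ae_mem_iff.2 hpos).and_eventually hA.delay).exists
  have h1' : history w u k ω₁ = history w u k ω₀ := h1
  rw [← h1']
  set At := history w u k ⁻¹' {history w u k ω₁} with hAt
  have hAtm : MeasurableSet At :=
    measurable_history hA.measurable_worker hA.measurable_scen k (measurableSet_singleton _)
  set g := G (z (m k ω₁) ω₁) with hg
  set lag := ∑ i ∈ Finset.range τ, (i : ℝ) *
    wInner p (z (k - τ + i + 1) ω₁ - z (k - τ + i) ω₁)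
      (z (k - τ + i + 1) ω₁ - z (k - τ + i) ω₁) with hlag
  set Φ : Fin S → ℝ := fun s => (wInner p (coordStep q (h k) (z k ω₁) g s - v)
      (coordStep q (h k) (z k ω₁) g s - v)
    + β * τ * wInner p (coordStep q (h k) (z k ω₁) g s - z k ω₁)
      (coordStep q (h k) (z k ω₁) g s - z k ω₁)) with hΦ
  obtain ⟨Ψ, hΨ⟩ : ∃ Ψ : Fin S → ℝ, ∀ s, Ψ s = Φ s + (β * lag + (1 - c) * h₀ * wInner p g g) :=
    ⟨_, fun _ => rfl⟩
  have hlhs : ∀ ω ∈ At, lyapunov p β τ v (fun j => z j ω) (k + 1)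
        + (1 - c) * h₀ * wInner p (G (z (m k ω) ω)) (G (z (m k ω) ω))
      = Ψ (u k ω) := by
    intro ω hω
    have hω' : history w u k ω = history w u k ω₁ := hω
    have hz := hA.congr_of_history hω'
    rw [lyapunov_succ _ (by omega), hA.direction_congr hω', hA.step, hA.direction_congr hω',
      hz k le_rfl]
    have e : ∑ i ∈ Finset.range τ, (i : ℝ) *
        wInner p (z (k - τ + i + 1) ω - z (k - τ + i) ω)
          (z (k - τ + i + 1) ω - z (k - τ + i) ω) = lag := by
      refine Finset.sum_congr rfl fun i hi => ?_
      have hi := Finset.mem_range.1 hi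
      rw [hz (k - τ + i + 1) (by omega), hz (k - τ + i) (by omega)]
    rw [e, hΨ]
    simp only [hΦ, hg]
    ring
  rw [setIntegral_congr_fun hAtm hlhs,
    setIntegral_congr_fun hAtm fun ω hω => hA.lyapunov_congr (by omega) hω,
    setIntegral_comp_eq_sum (hA.measurable_scen k), setIntegral_const, smul_eq_mul]
  -- From update `τ + 1` on, a worker cannot still hold its initial scenario, so the sampling
  -- hypothesis applies.
  have hm0 : m k ω₁ ≠ 0 := by have := hd k; omega
  have hs : ∀ s, P.real (At ∩ u k ⁻¹' {s}) = q s * P.real At := by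
    intro s
    have := hA.sampled k s (fun j => w j ω₁) (fun j => u j ω₁) (hA.returned k ω₁ hm0)
    convert this using 2
    · ext ω
      simp only [hAt, Set.mem_inter_iff, Set.mem_preimage, Set.mem_singleton_iff, history_eq_iff,
        Set.mem_ofPred_eq, and_assoc]
    · congr 1
      ext ω
      simp only [hAt, Set.mem_preimage, Set.mem_singleton_iff, history_eq_iff, Set.mem_ofPred_eq]
  simp only [hs, hΨ]
  have hdec := hG.expected_decrease hp hβ hq hq_sum (hA.read_le k ω₁) (hd k)
    (by omega : τ ≤ k) (hh₀.trans_le (hh k)) (hhc k) (fun j => z j ω₁) hv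
  have hsum : ∑ s, q s * P.real At * (Φ s + (β * lag + (1 - c) * h₀ * wInner p g g))
      = P.real At * (∑ s, q s * Φ s + (β * lag + (1 - c) * h₀ * wInner p g g)) := by
    have e : ∀ s, q s * P.real At * (Φ s + (β * lag + (1 - c) * h₀ * wInner p g g))
        = P.real At * (q s * Φ s) + q s * (P.real At * (β * lag + (1 - c) * h₀ * wInner p g g)) :=
      fun s => by ring
    simp only [e, Finset.sum_add_distrib, ← Finset.mul_sum, ← Finset.sum_mul, hq_sum]
    ring
  rw [hsum]
  refine mul_le_mul_of_nonneg_left ?_ measureReal_nonneg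
  have hl : lyapunov p β τ v (fun j => z j ω₁) k = wInner p (z k ω₁ - v) (z k ω₁ - v)
      + β * ∑ i ∈ Finset.range τ, wInner p (z (k - τ + i + 1) ω₁ - z (k - τ + i) ω₁)
        (z (k - τ + i + 1) ω₁ - z (k - τ + i) ω₁) + β * lag := by
    rw [lyapunov, hlag, add_assoc, ← mul_add, ← Finset.sum_add_distrib]
    congr 2
    exact Finset.sum_congr rfl fun i _ => by ring
  rw [hl]
  have h3 : (1 - c) * h₀ * wInner p g g ≤ (1 - c) * h k * wInner p g g :=
    mul_le_mul_of_nonneg_right (mul_le_mul_of_nonneg_left (hh k) (by linarith))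
      (wInner_self_nonneg hp g)
  simp only [hΦ] at hdec ⊢
  linarith

/-- The drift on atoms extends to the whole history σ-algebra, and the Robbins–Siegmund theorem
applies from update `τ + 1` on; the null set depends on `v`. -/
theorem ae_lyapunov_tendsto (hA : IsAsyncIteration P q G h τ w u z m) (hp : ∀ s, 0 < p s)
    (hG : Cocoercive p G) (hβ : 0 < β) (hq : ∀ s, β ^ 2 ≤ q s) (hq_sum : ∑ s, q s = 1)
    {c h₀ : ℝ} (hc1 : c < 1) (hh₀ : 0 < h₀) (hh : ∀ k, h₀ ≤ h k)
    (hhc : ∀ k, h k * (2 * τ * β + 1) ≤ c * β ^ 2) (hv : G v = 0) :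
    ∀ᵐ ω ∂P, (∃ a, Tendsto (fun k => lyapunov p β τ v (fun j => z j ω) k) atTop (𝓝 a)) ∧
      Tendsto (fun k => wInner p (G (z (m k ω) ω)) (G (z (m k ω) ω))) atTop (𝓝 0) := by
  have hc0 : 0 < (1 - c) * h₀ := mul_pos (by linarith) hh₀
  have hH := measurable_history hA.measurable_worker hA.measurable_scen
  have hUf : ∀ k, (fun ω => (1 - c) * h₀ * wInner p (G (z (m k ω) ω)) (G (z (m k ω) ω)))
      |>.FactorsThrough (history w u k) := fun k ω ω' hω => by
    simp only [hA.direction_congr hω]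
  have hVf : ∀ k, (fun ω => lyapunov p β τ v (fun j => z j ω) (k + (τ + 1)))
      |>.FactorsThrough (history w u (k + (τ + 1))) := fun k => hA.lyapunov_congr (by omega)
  have key := ae_tendsto_and_summable_of_drift (P := P)
    (ℱ := historyFiltration hA.measurable_worker hA.measurable_scen (τ + 1))
    (V := fun k ω => lyapunov p β τ v (fun j => z j ω) (k + (τ + 1)))
    (U := fun k ω => (1 - c) * h₀ * wInner p (G (z (m (k + (τ + 1)) ω) ω))
      (G (z (m (k + (τ + 1)) ω) ω)))
    (fun k ω => lyapunov_nonneg hp hβ _ _)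
    (fun k ω => mul_nonneg hc0.le (wInner_self_nonneg hp _))
    (fun k => (measurable_comap_of_factorsThrough (hVf k)).stronglyMeasurable)
    (fun k => (measurable_comap_of_factorsThrough (hUf _)).stronglyMeasurable)
    (fun k => integrable_of_factorsThrough (hH _) (hVf k))
    (fun k => integrable_of_factorsThrough (hH _) (hUf _))
    (fun k A hAm => by
      have e : k + 1 + (τ + 1) = k + (τ + 1) + 1 := by omega
      simp only [e]
      have hi := hVf (k + 1)
      simp only [e] at hi
      exact setIntegral_le_of_atoms (hH (k + (τ + 1)))
        ((integrable_of_factorsThrough (hH _) hi).add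
          (integrable_of_factorsThrough (hH _) (hUf _)))
        (integrable_of_factorsThrough (hH _) (hVf k))
        (fun ω₀ hpos => hA.setIntegral_atom_le hp hG hβ hq hq_sum hc1 hh₀ hh hhc hv (by omega)
          ω₀ hpos) hAm)
  filter_upwards [key] with ω hω
  obtain ⟨⟨a, ha⟩, hs⟩ := hω
  refine ⟨⟨a, (tendsto_add_atTop_iff_nat (τ + 1)).1 ha⟩, ?_⟩
  have h1 := hs.tendsto_atTop_zero.const_mul ((1 - c) * h₀)⁻¹
  simp only [inv_mul_cancel_left₀ hc0.ne', mul_zero] at h1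
  exact (tendsto_add_atTop_iff_nat
    (f := fun k => wInner p (G (z (m k ω) ω)) (G (z (m k ω) ω))) (τ + 1)).1 h1

variable [FiniteDimensional ℝ E]

/-- Almost sure convergence of the asynchronous iteration to a zero of the operator. -/
theorem ae_tendsto (hA : IsAsyncIteration P q G h τ w u z m) (hp : ∀ s, 0 < p s)
    (hG : Cocoercive p G) (hβ : 0 < β) (hq : ∀ s, β ^ 2 ≤ q s) (hq_sum : ∑ s, q s = 1)
    {c h₀ : ℝ} (hc1 : c < 1) (hh₀ : 0 < h₀) (hh : ∀ k, h₀ ≤ h k)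
    (hhc : ∀ k, h k * (2 * τ * β + 1) ≤ c * β ^ 2) (hz : ∃ x, G x = 0) :
    ∀ᵐ ω ∂P, ∃ x, G x = 0 ∧ Tendsto (fun k => z k ω) atTop (𝓝 x) := by
  obtain ⟨D, hDsub, hDc, hDd⟩ :=
    (TopologicalSpace.IsSeparable.of_separableSpace {v | G v = 0}).exists_countable_dense_subset
  have hDne : D.Nonempty := by
    obtain ⟨x, hx⟩ := hz
    exact closure_nonempty_iff.1 ⟨x, hDd hx⟩
  -- Countability of `D` gives one null set for all `v ∈ D`.
  have hae := (ae_ball_iff hDc).2 fun v hv =>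
    hA.ae_lyapunov_tendsto hp hG hβ hq hq_sum hc1 hh₀ hh hhc (hDsub hv)
  filter_upwards [hae, hA.delay] with ω hω hd
  have hg0 : Tendsto (fun k => wInner p (G (z (m k ω) ω)) (G (z (m k ω) ω))) atTop (𝓝 0) :=
    (hω _ hDne.some_mem).2
  have hstep : Tendsto (fun k => wInner p (z (k + 1) ω - z k ω) (z (k + 1) ω - z k ω)) atTop
      (𝓝 0) := by
    set B : ℝ := (c * β ^ 2 / β ^ 2) ^ 2 with hB
    have hle : ∀ k, wInner p (z (k + 1) ω - z k ω) (z (k + 1) ω - z k ω)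
        ≤ B * wInner p (G (z (m k ω) ω)) (G (z (m k ω) ω)) := by
      intro k
      have hk0 : 0 < h k := hh₀.trans_le (hh k)
      rw [hA.step, wInner_coordStep_sub_self]
      refine mul_le_mul ?_ (mul_norm_sq_le_wInner_self hp _ _)
        (mul_nonneg (hp _).le (by positivity)) (by positivity)
      have hq0 : 0 < q (u k ω) := lt_of_lt_of_le (by positivity) (hq _)
      have h1 : h k ≤ c * β ^ 2 := by
        refine le_trans ?_ (hhc k)
        refine le_mul_of_one_le_right hk0.le ?_
        have : 0 ≤ 2 * (τ : ℝ) * β := by positivity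
        linarith
      exact pow_le_pow_left₀ (by positivity)
        (div_le_div₀ (hk0.le.trans h1) h1 (by positivity) (hq _)) 2
    exact squeeze_zero (fun k => wInner_self_nonneg hp _) hle (by simpa using hg0.const_mul B)
  have hshift : ∀ i, Tendsto (fun k => k - τ + i) atTop atTop := fun i =>
    tendsto_atTop_mono (fun k => Nat.le_add_right _ i) (tendsto_sub_atTop_nat τ)
  -- A sum of at most `τ` recent steps, each tending to zero; the Lipschitz bound then transfers `G
  -- → 0` from the points read to the iterates.
  have hdiff : Tendsto (fun k => z k ω - z (m k ω) ω) atTop (𝓝 0) := by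
    have h1 : Tendsto (fun k => ‖z (k + 1) ω - z k ω‖) atTop (𝓝 0) :=
      tendsto_zero_iff_norm_tendsto_zero.1 (tendsto_zero_of_wInner_self hp hstep)
    have h2 : Tendsto (fun k => ∑ i ∈ Finset.range τ,
        ‖z (k - τ + i + 1) ω - z (k - τ + i) ω‖) atTop (𝓝 0) := by
      rw [← Finset.sum_const_zero (s := Finset.range τ)]
      refine tendsto_finsetSum _ fun i _ => ?_
      exact h1.comp (hshift i)
    refine squeeze_zero_norm' ?_ h2
    filter_upwards [eventually_ge_atTop τ] with k hk
    have hr : ∑ i ∈ Finset.range τ, ‖z (k - τ + i + 1) ω - z (k - τ + i) ω‖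
        = ∑ i ∈ Finset.Ico (k - τ) k, ‖z (i + 1) ω - z i ω‖ := by
      rw [Finset.sum_Ico_eq_sum_range, Nat.sub_sub_self hk]
    rw [hr, ← Finset.sum_Ico_sub (fun j => z j ω) (hA.read_le k ω)]
    refine (norm_sum_le _ _).trans (Finset.sum_le_sum_of_subset_of_nonneg ?_
      fun i _ _ => norm_nonneg _)
    have := hd k
    exact Finset.Ico_subset_Ico (by omega) le_rfl
  have hwc : Continuous fun x : Fin S → E => wInner p x x := continuous_wInner_self
  have hG0 : Tendsto (fun k => G (z k ω)) atTop (𝓝 0) := by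
    have h1 : Tendsto (fun k => G (z (m k ω) ω)) atTop (𝓝 0) :=
      tendsto_zero_of_wInner_self hp hg0
    have h2 : Tendsto (fun k => G (z k ω) - G (z (m k ω) ω)) atTop (𝓝 0) := by
      refine tendsto_zero_of_wInner_self hp ?_
      refine squeeze_zero (fun k => wInner_self_nonneg hp _)
        (fun k => hG.wInner_sub_le hp _ _) ?_
      have := ((hwc.tendsto 0).comp hdiff).const_mul 4
      simpa [wInner_zero_left] using this
    simpa using h2.add h1
  refine exists_tendsto_of_wInner_tendsto hp (hG.continuous hp) hG0 hDne hDd fun v hv => ?_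
  obtain ⟨a, ha⟩ := (hω v hv).1
  refine ⟨a, ?_⟩
  have h2 : Tendsto (fun k => β * ∑ i ∈ Finset.range τ, ((i : ℝ) + 1) *
      wInner p (z (k - τ + i + 1) ω - z (k - τ + i) ω)
        (z (k - τ + i + 1) ω - z (k - τ + i) ω)) atTop (𝓝 0) := by
    have : Tendsto (fun k => ∑ i ∈ Finset.range τ, ((i : ℝ) + 1) *
        wInner p (z (k - τ + i + 1) ω - z (k - τ + i) ω)
          (z (k - τ + i + 1) ω - z (k - τ + i) ω)) atTop (𝓝 0) := by
      rw [← Finset.sum_const_zero (s := Finset.range τ)]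
      refine tendsto_finsetSum _ fun i _ => ?_
      have h3 := hstep.comp (hshift i)
      simpa using h3.const_mul ((i : ℝ) + 1)
    simpa using this.const_mul β
  have h3 := ha.sub h2
  simp only [lyapunov, add_sub_cancel_right, sub_zero] at h3
  exact h3

end IsAsyncIteration

end AsyncIteration

/-! ### Progressive hedging as an asynchronous iteration -/

namespace Problem

section Run

variable {S T M : ℕ} {n : Fin T → ℕ} {Ξ : Fin (T - 1) → Type*} {D : Problem S T n Ξ}
  {x₀ : Decision S n} {s₀ : Fin M → Fin S} {q : Fin S → ℝ} {μ : ℝ} {η : ℕ → ℝ}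

/-- What the workers hold is determined by their scenarios and by the master variable at the time
they were last fed. -/
theorem Assumptions.run_worker (hD : D.Assumptions) (hx₀ : x₀ ∈ D.nonant) (w : ℕ → Fin M)
    (draw : ℕ → Fin S) (k : ℕ) (j : Fin M) :
    (D.run x₀ s₀ q μ η w draw k).start j ≤ k ∧
    (D.run x₀ s₀ q μ η w draw k).old j
      = D.proj (D.run x₀ s₀ q μ η w draw ((D.run x₀ s₀ q μ η w draw k).start j)).z
        ((D.run x₀ s₀ q μ η w draw k).scen j) ∧
    (D.run x₀ s₀ q μ η w draw k).sent j
      = (2 : ℝ) • D.proj (D.run x₀ s₀ q μ η w draw ((D.run x₀ s₀ q μ η w draw k).start j)).z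
          ((D.run x₀ s₀ q μ η w draw k).scen j)
        - (D.run x₀ s₀ q μ η w draw ((D.run x₀ s₀ q μ η w draw k).start j)).z
          ((D.run x₀ s₀ q μ η w draw k).scen j) := by
  induction k with
  | zero =>
    refine ⟨le_rfl, ?_, ?_⟩
    -- The initial feed is consistent with later ones because `x₀ ∈ 𝒲` is fixed by the projection
    -- and by the reflection.
    · change x₀ (s₀ j) = D.proj x₀ (s₀ j)
      rw [hD.proj_eq_self hx₀]
    · change x₀ (s₀ j) = (2 : ℝ) • D.proj x₀ (s₀ j) - x₀ (s₀ j)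
      rw [hD.proj_eq_self hx₀, two_smul]
      abel
  | succ k ih =>
    have hstart : (D.run x₀ s₀ q μ η w draw (k + 1)).start
        = Function.update (D.run x₀ s₀ q μ η w draw k).start (w k) (k + 1) := rfl
    have hscen : (D.run x₀ s₀ q μ η w draw (k + 1)).scen
        = Function.update (D.run x₀ s₀ q μ η w draw k).scen (w k) (draw k) := rfl
    have hold : (D.run x₀ s₀ q μ η w draw (k + 1)).old
        = Function.update (D.run x₀ s₀ q μ η w draw k).old (w k)
          (D.proj (D.run x₀ s₀ q μ η w draw (k + 1)).z (draw k)) := rfl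
    have hsent : (D.run x₀ s₀ q μ η w draw (k + 1)).sent
        = Function.update (D.run x₀ s₀ q μ η w draw k).sent (w k)
          ((2 : ℝ) • D.proj (D.run x₀ s₀ q μ η w draw (k + 1)).z (draw k)
            - (D.run x₀ s₀ q μ η w draw (k + 1)).z (draw k)) := rfl
    rw [hold, hsent, hscen, hstart]
    by_cases hj : j = w k
    · subst hj
      simp only [Function.update_self]
      exact ⟨le_rfl, by simp⟩
    · simp only [Function.update_of_ne hj]
      exact ⟨ih.1.trans k.le_succ, ih.2⟩

theorem Assumptions.run_z_succ (hD : D.Assumptions) (hx₀ : x₀ ∈ D.nonant) (w : ℕ → Fin M)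
    (draw : ℕ → Fin S) (k : ℕ) :
    (D.run x₀ s₀ q μ η w draw (k + 1)).z
      = coordStep q (η k / S) (D.run x₀ s₀ q μ η w draw k).z
        (D.drOp μ (D.run x₀ s₀ q μ η w draw ((D.run x₀ s₀ q μ η w draw k).start (w k))).z)
        (D.usedScen x₀ s₀ q μ η w draw k) := by
  obtain ⟨-, hold, hsent⟩ := hD.run_worker (s₀ := s₀) (q := q) (μ := μ) (η := η) hx₀ w draw k (w k)
  have h : (D.run x₀ s₀ q μ η w draw (k + 1)).z
    = D.updateZ q μ (η k) (w k) (D.run x₀ s₀ q μ η w draw k) := rfl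
  rw [h, updateZ, hold, hsent]
  change Function.update _ (D.usedScen x₀ s₀ q μ η w draw k) _ = _
  ext1 s
  by_cases hs : s = D.usedScen x₀ s₀ q μ η w draw k
  · subst hs
    have e : ∀ (a b z : Row n) (r r' : ℝ), r = r' → z + r • (b - a) = z - r' • (a - b) := by
      rintro a b z r _ rfl
      rw [← neg_sub a b, smul_neg, ← sub_eq_add_neg]
    rw [Function.update_self, coordStep, Pi.sub_apply, Pi.single_eq_same, drOp, smul_smul]
    refine e _ _ _ _ _ ?_
    rw [div_div, div_mul_eq_mul_div, mul_comm (2 : ℝ)]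
    rfl
  · rw [Function.update_of_ne hs, coordStep, Pi.sub_apply, Pi.single_eq_of_ne hs, sub_zero]

theorem run_congr {w w' : ℕ → Fin M} {draw draw' : ℕ → Fin S} (k : ℕ)
    (hw : ∀ j < k, w j = w' j) (hd : ∀ j < k, draw j = draw' j) :
    D.run x₀ s₀ q μ η w draw k = D.run x₀ s₀ q μ η w' draw' k := by
  induction k with
  | zero => rfl
  | succ k ih =>
    simp only [run]
    rw [ih (fun j hj => hw j (by omega)) fun j hj => hd j (by omega), hw k (by omega),
      hd k (by omega)]

/-- Feeding times are set by the order of return alone. Hence the read index is part of the history,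
on which the incorporated scenario is conditioned. -/
theorem start_congr {w w' : ℕ → Fin M} (draw draw' : ℕ → Fin S) (k : ℕ)
    (hw : ∀ j < k, w j = w' j) :
    (D.run x₀ s₀ q μ η w draw k).start = (D.run x₀ s₀ q μ η w' draw' k).start := by
  induction k with
  | zero => rfl
  | succ k ih =>
    simp only [run, step]
    rw [ih fun j hj => hw j (by omega), hw k (by omega)]

theorem exists_of_start_ne_zero (w : ℕ → Fin M) (draw : ℕ → Fin S) (k : ℕ) (j : Fin M)
    (h : (D.run x₀ s₀ q μ η w draw k).start j ≠ 0) : ∃ i < k, w i = j := by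
  induction k with
  | zero => exact absurd rfl h
  | succ k ih =>
    by_cases hj : j = w k
    · exact ⟨k, k.lt_succ_self, hj.symm⟩
    · simp only [run, step, Function.update_of_ne hj] at h
      obtain ⟨i, hi, e⟩ := ih h
      exact ⟨i, by omega, e⟩

variable {Ω : Type*} [MeasurableSpace Ω]

theorem measurable_usedScen {w : ℕ → Ω → Fin M} {draw : ℕ → Ω → Fin S}
    (hw : ∀ k, Measurable (w k)) (hdraw : ∀ k, Measurable (draw k)) (k : ℕ) :
    Measurable fun ω => D.usedScen x₀ s₀ q μ η (fun j => w j ω) (fun j => draw j ω) k := by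
  refine (measurable_comap_of_factorsThrough (H := history w draw k) fun ω ω' h => ?_).mono
    (measurable_history hw hdraw k).comap_le le_rfl
  rw [history_eq_iff] at h
  simp only [usedScen]
  rw [run_congr k (fun j hj => h.1 j hj.le) h.2, h.1 k le_rfl]

/-- Asynchronous progressive hedging is an asynchronous coordinate iteration for the
Douglas-Rachford operator. -/
theorem Assumptions.isAsyncIteration_run (hD : D.Assumptions) (hx₀ : x₀ ∈ D.nonant) {τ : ℕ}
    {P : Measure Ω} {w : ℕ → Ω → Fin M} (hw : ∀ k, Measurable (w k)) {draw : ℕ → Ω → Fin S}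
    (hdraw : ∀ k, Measurable (draw k))
    (hsample : SampledFrom P q w
      (fun k ω => D.usedScen x₀ s₀ q μ η (fun j => w j ω) (fun j => draw j ω) k))
    (hdelay : ∀ᵐ ω ∂P, ∀ k,
      D.delay x₀ s₀ q μ η (fun j => w j ω) (fun j => draw j ω) k ≤ τ) :
    IsAsyncIteration P q (D.drOp μ) (fun k => η k / S) τ w
      (fun k ω => D.usedScen x₀ s₀ q μ η (fun j => w j ω) (fun j => draw j ω) k)
      (fun k ω => (D.run x₀ s₀ q μ η (fun j => w j ω) (fun j => draw j ω) k).z)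
      (fun k ω => (D.run x₀ s₀ q μ η (fun j => w j ω) (fun j => draw j ω) k).start (w k ω)) where
  measurable_worker := hw
  measurable_scen := measurable_usedScen hw hdraw
  init _ _ := rfl
  step k ω := hD.run_z_succ hx₀ (fun j => w j ω) (fun j => draw j ω) k
  read_le k ω := (hD.run_worker hx₀ (fun j => w j ω) (fun j => draw j ω) k (w k ω)).1
  read_congr k ω ω' h := by
    rw [start_congr _ (fun j => draw j ω') k fun j hj => h j hj.le, h k le_rfl]
  returned k ω h := exists_of_start_ne_zero _ _ k _ h
  delay := by
    filter_upwards [hdelay] with ω hω k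
    have := hω k
    rw [delay] at this
    omega
  sampled := hsample

end Run

end Problem

end ProgHedging

/-! ### Conclusion -/

theorem theorem3 {S T M : ℕ} {n : Fin T → ℕ} {Ξ : Fin (T - 1) → Type*}
    (D : ProgHedging.Problem S T n Ξ) (hD : D.Assumptions)
    -- sampling probabilities, proximal parameter, initialization
    (q : Fin S → ℝ) (hq : ∀ s, 0 ≤ q s) (hq_sum : ∑ s, q s = 1)
    (μ : ℝ) (hμ : 0 < μ)
    (x₀ : ProgHedging.Decision S n) (hx₀ : x₀ ∈ D.nonant) (s₀ : Fin M → Fin S)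
    -- stepsizes
    (τ : ℕ) (c ηmin : ℝ) (hc : 0 < c) (hc1 : c < 1) (η : ℕ → ℝ) (hηmin : 0 < ηmin)
    (hη : ∀ k, ηmin ≤ η k ∧
      η k ≤ c * S * (⨅ s, q s) / (2 * τ * Real.sqrt (⨅ s, q s) + 1))
    -- returning workers and drawn scenarios
    {Ω : Type*} [MeasurableSpace Ω] (P : Measure Ω) [IsProbabilityMeasure P]
    (w : ℕ → Ω → Fin M) (hw : ∀ k, Measurable (w k))
    (draw : ℕ → Ω → Fin S) (hdraw : ∀ k, Measurable (draw k))
    (hsample : ProgHedging.SampledFrom P q w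
      (fun k ω => D.usedScen x₀ s₀ q μ η (fun j => w j ω) (fun j => draw j ω) k))
    -- bounded delays
    (hdelay : ∀ᵐ ω ∂P, ∀ k,
      D.delay x₀ s₀ q μ η (fun j => w j ω) (fun j => draw j ω) k ≤ τ) :
    (∀ᵐ ω ∂P, ∀ k,
      D.output x₀ s₀ q μ η (fun j => w j ω) (fun j => draw j ω) k ∈ D.nonant) ∧
    ∃ X : Ω → ProgHedging.Decision S n, Measurable X ∧
      (∀ᵐ ω ∂P, X ω ∈ D.solutions) ∧
      ∀ᵐ ω ∂P, Tendsto
        (fun k => D.output x₀ s₀ q μ η (fun j => w j ω) (fun j => draw j ω) k)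
        atTop (𝓝 (X ω)) := by
  refine ⟨Eventually.of_forall fun ω k => D.proj_mem _, ?_⟩
  set qmin := ⨅ s, q s with hqmin
  have hqmin0 : 0 ≤ qmin := Real.iInf_nonneg hq
  have hqle : ∀ s, qmin ≤ q s := fun s => ciInf_le (Set.finite_range q).bddBelow s
  have hβ0 : 0 ≤ Real.sqrt qmin := Real.sqrt_nonneg _
  have hden : 0 < 2 * (τ : ℝ) * Real.sqrt qmin + 1 := by positivity
  -- Positivity of `S` and of `qmin` is forced by the existence of an admissible positive stepsize.
  have hnum : 0 < c * S * qmin := by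
    have h1 : 0 < c * S * qmin / (2 * τ * Real.sqrt qmin + 1) :=
      hηmin.trans_le ((hη 0).1.trans (hη 0).2)
    exact (div_pos_iff_of_pos_right hden).1 h1
  have hqpos : 0 < qmin := lt_of_le_of_ne hqmin0 fun h => by simp [← h] at hnum
  have hS : (0 : ℝ) < S := by
    rcases Nat.eq_zero_or_pos S with h | h
    · rw [h] at hnum; simp at hnum
    · exact_mod_cast h
  have hβ : 0 < Real.sqrt qmin := Real.sqrt_pos.2 hqpos
  have hβsq : Real.sqrt qmin ^ 2 = qmin := Real.sq_sqrt hqmin0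
  have hA := hD.isAsyncIteration_run hx₀ hw hdraw hsample hdelay
  have hconv := hA.ae_tendsto hD.p_pos (hD.cocoercive_drOp hμ) hβ
    (fun s => hβsq.trans_le (hqle s)) hq_sum hc1 (div_pos hηmin hS)
    (fun k => div_le_div_of_nonneg_right (hη k).1 hS.le)
    (fun k => by
      rw [hβsq, div_mul_eq_mul_div, div_le_iff₀ hS]
      have := (le_div_iff₀ hden).1 (hη k).2
      linarith)
    (hD.exists_drOp_eq_zero hμ)
  have hlim : ∀ᵐ ω ∂P, ∃ x ∈ D.solutions, Tendsto
      (fun k => D.output x₀ s₀ q μ η (fun j => w j ω) (fun j => draw j ω) k) atTop (𝓝 x) := by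
    filter_upwards [hconv] with ω hω
    obtain ⟨z, hz, hzt⟩ := hω
    exact ⟨D.proj z, hD.proj_mem_solutions hμ hz, (D.continuous_proj.tendsto z).comp hzt⟩
  have hmeas : ∀ k, Measurable fun ω =>
      D.output x₀ s₀ q μ η (fun j => w j ω) (fun j => draw j ω) k := fun k =>
    D.continuous_proj.measurable.comp
      ((ProgHedging.measurable_comap_of_factorsThrough fun ω ω' h =>
        hA.congr_of_history h k le_rfl).mono
        (ProgHedging.measurable_history hA.measurable_worker hA.measurable_scen k).comap_le le_rfl)
  -- The pointwise limits were chosen separately for each `ω`; this provides a measurable version,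
  -- which uniqueness of limits places in the solution set.
  obtain ⟨X, hXm, hX⟩ := measurable_limit_of_tendsto_metrizable_ae
    (fun k => (hmeas k).aemeasurable) (hlim.mono fun ω ⟨x, _, hx⟩ => ⟨x, hx⟩)
  refine ⟨X, hXm, ?_, hX⟩
  filter_upwards [hlim, hX] with ω h1 h2
  obtain ⟨x, hx, hxt⟩ := h1
  rwa [tendsto_nhds_unique h2 hxt]
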